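/- Let $f\colon\mathbb R\to\mathbb R$ be odd and of class $C^3$, and consider $$\dot x=f(x)+h\cos(2\pi t),\qquad h\in\mathbb R. \tag{1}$$ Call a 1-periodic solution $x$ symmetric (it then has zero mean) if $Rx=x$, where $(Rx)(t)=-x(t+1/2)$. "Stable" means Lyapunov stable as $t\to+\infty$, "unstable" means not stable, and closeness of periodic solutions is measured uniformly in $t$. Let $x_0(h,\cdot)$, for $h$ near $h_{cs}$, be symmetric 1-periodic solutions of (1) that converge uniformly to $x_0:=x_0(h_{cs},\cdot)$ as $h\to h_{cs}$. Suppose that this family undergoes a stability-gaining bifurcation at $h_{cs}$: $\int_0^1 f'(x_0(s))\,ds=0$, and $x_0(h,\cdot)$ is unstable for $h<h_{cs}$ close to $h_{cs}$ and stable for $h>h_{cs}$ close to $h_{cs}$. Put $\Phi(x,h)=\dot x-f(x)-h\cos(2\pi t)$ for $x$ in the space $C^1_p$ of 1-periodic $C^1$ functions, $v(t)=\exp\int_0^t f'(x_0(s))\,ds$, $v^*=1/v$, $\langle y,z\rangle=\int_0^1 yz\,dt$ and $Ey=y-\frac{\langle v^*,y\rangle}{\langle v^*,v^*\rangle}v^*$.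 A Lyapunov–Schmidt reduced function at $(x_0,h_{cs})$ is a function $g(x,h)$ such that for all $(x,h)$ near $(0,h_{cs})$ $$g(x,h)=\big\langle v^*,\Phi(x_0+xv+W(x,h),h)\big\rangle ,$$ where $W(x,h)\in C^1_p$, $\langle v,W(x,h)\rangle=0$, $E\,\Phi(x_0+xv+W(x,h),h)=0$, and $W(x,h)\to0$ in $C^1_p$ as $(x,h)\to(0,h_{cs})$. Then a reduced function exists which is $C^3$ near $(0,h_{cs})$, and for every reduced function $g$: 1. if $g_{xxx}(0,h_{cs})>0$, the bifurcation is a subcritical pitchfork: in some fixed neighbourhood of $x_0$, for $h<h_{cs}$ close to $h_{cs}$ there are exactly three 1-periodic solutions of (1), namely $x_0(h,\cdot)$ and two stable non-symmetric solutions $y_h$, $Ry_h$, which depend continuously on $h$ and converge to $x_0$ as $h\to h_{cs}$; and for $h\ge h_{cs}$ close to $h_{cs}$ the only one is $x_0(h,\cdot)$; 2. if $g_{xxx}(0,h_{cs})<0$, the bifurcation is a supercritical pitchfork: in some fixed neighbourhood of $x_0$, for $h>h_{cs}$ close to $h_{cs}$ there are exactly three 1-periodic solutions of (1), namely $x_0(h,\cdot)$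 and two unstable non-symmetric solutions $y_h$, $Ry_h$, which depend continuously on $h$ and converge to $x_0$ as $h\to h_{cs}$; and for $h\le h_{cs}$ close to $h_{cs}$ the only one is $x_0(h,\cdot)$. -/

import Mathlib

open Filter Topology

namespace PeriodicBistable

/-- `x` is a continuously differentiable `1`-periodic function, i.e. an element of the space
`C¹ₚ([0,1])`. -/
def IsC1Periodic (x : ℝ → ℝ) : Prop :=
  ContDiff ℝ 1 x ∧ Function.Periodic x 1

/-- The operator `Φ(x, h) = x' - f(x) - h cos(2πt)`. -/
noncomputable def Phi (f : ℝ → ℝ) (h : ℝ) (x : ℝ → ℝ) : ℝ → ℝ :=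
  fun t => deriv x t - f (x t) - h * Real.cos (2 * Real.pi * t)

/-- `x` is a `1`-periodic solution of `x' = f(x) + h cos(2πt)`. -/
def IsPeriodicSolution (f : ℝ → ℝ) (h : ℝ) (x : ℝ → ℝ) : Prop :=
  IsC1Periodic x ∧ ∀ t, Phi f h x t = 0

/-- The symmetry `(R x)(t) = -x(t + 1/2)`. -/
noncomputable def reflect (x : ℝ → ℝ) : ℝ → ℝ :=
  fun t => -x (t + 1 / 2)

/-- `x` lies within uniform distance `r` of `y`. -/
def Near (r : ℝ) (x y : ℝ → ℝ) : Prop :=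
  ∀ t, |x t - y t| < r

/-- Lyapunov stability (forward in time, starting at time `0`) of the solution `x` of
`x' = f(x) + h cos(2πt)`. The perturbed solutions `y` are taken on arbitrary compact intervals
`[0, T]`, so that those which blow up in finite time are not ignored. -/
def IsStable (f : ℝ → ℝ) (h : ℝ) (x : ℝ → ℝ) : Prop :=
  ∀ ε > 0, ∃ δ > 0, ∀ (T : ℝ) (y : ℝ → ℝ),
    (∀ t ∈ Set.Icc 0 T,
      HasDerivWithinAt y (f (y t) + h * Real.cos (2 * Real.pi * t)) (Set.Icc 0 T) t) →
    |y 0 - x 0| < δ → ∀ t ∈ Set.Icc 0 T, |y t - x t| < ε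

/-- `X h`, for `h` near `hc`, is a family of symmetric (hence zero-mean) `1`-periodic solutions
which is continuous at `hc`. -/
def IsSymmetricBranch (f : ℝ → ℝ) (hc : ℝ) (X : ℝ → ℝ → ℝ) : Prop :=
  (∀ᶠ h in 𝓝 hc, IsPeriodicSolution f h (X h) ∧ reflect (X h) = X h) ∧
  ∀ ε > 0, ∀ᶠ h in 𝓝 hc, Near ε (X h) (X hc)

/-- The branch `X` undergoes a stability-gaining bifurcation at `hc`: the bifurcation condition
`∫₀¹ f'(x₀) = 0` holds for `x₀ = X hc`, and as `h` increases through `hc` the solution `X h` turns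
from unstable to stable. -/
def IsStabilityGaining (f : ℝ → ℝ) (hc : ℝ) (X : ℝ → ℝ → ℝ) : Prop :=
  (∫ s in (0 : ℝ)..1, deriv f (X hc s)) = 0 ∧
  (∀ᶠ h in 𝓝[<] hc, ¬ IsStable f h (X h)) ∧
  (∀ᶠ h in 𝓝[>] hc, IsStable f h (X h))

/-- The spanning function `v` of the kernel of the linearisation `L y = y' - f'(x₀) y`. -/
noncomputable def kerFun (f x₀ : ℝ → ℝ) : ℝ → ℝ :=
  fun t => Real.exp (∫ s in (0 : ℝ)..t, deriv f (x₀ s))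

/-- The spanning function `v*` of the orthogonal complement of the range of `L`. -/
noncomputable def cokerFun (f x₀ : ℝ → ℝ) : ℝ → ℝ :=
  fun t => Real.exp (-∫ s in (0 : ℝ)..t, deriv f (x₀ s))

/-- The inner product of `L²([0,1])`. -/
noncomputable def ip (x y : ℝ → ℝ) : ℝ :=
  ∫ t in (0 : ℝ)..1, x t * y t

/-- The orthogonal projection `E` onto the range of `L`, i.e. onto the complement of `v*`. -/
noncomputable def rangeProj (f x₀ y : ℝ → ℝ) : ℝ → ℝ :=
  fun t => y t - ip (cokerFun f x₀) y / ip (cokerFun f x₀) (cokerFun f x₀) * cokerFun f x₀ t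

/-- The function `x₀ + x v + w`. -/
noncomputable def ansatz (f x₀ : ℝ → ℝ) (x : ℝ) (w : ℝ → ℝ) : ℝ → ℝ :=
  fun t => x₀ t + x * kerFun f x₀ t + w t

/-- `g` is a Lyapunov-Schmidt reduced function of `Φ` at `(x₀, hc)`: near `(0, hc)`,
`g(x, h) = ⟨v*, Φ(x₀ + x v + W(x, h), h)⟩`, where `W(x, h)` is the small solution, in the
`L²`-orthogonal complement of `v` in `C¹ₚ`, of `E Φ(x₀ + x v + W(x, h), h) = 0`; smallness means
that `W(x, h) → 0` in `C¹ₚ` as `(x, h) → (0, hc)`. -/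
def IsReducedFunction (f : ℝ → ℝ) (hc : ℝ) (x₀ : ℝ → ℝ) (g : ℝ → ℝ → ℝ) : Prop :=
  ∃ W : ℝ → ℝ → ℝ → ℝ,
    (∀ᶠ p : ℝ × ℝ in 𝓝 ((0 : ℝ), hc),
      IsC1Periodic (W p.1 p.2) ∧
      ip (kerFun f x₀) (W p.1 p.2) = 0 ∧
      (∀ t, rangeProj f x₀ (Phi f p.2 (ansatz f x₀ p.1 (W p.1 p.2))) t = 0) ∧
      g p.1 p.2 = ip (cokerFun f x₀) (Phi f p.2 (ansatz f x₀ p.1 (W p.1 p.2)))) ∧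
    ∀ ε > 0, ∀ᶠ p : ℝ × ℝ in 𝓝 ((0 : ℝ), hc),
      ∀ t, |W p.1 p.2 t| < ε ∧ |deriv (W p.1 p.2) t| < ε

/-- The third derivative `g_xxx(0, h)`. -/
noncomputable def gxxx (g : ℝ → ℝ → ℝ) (h : ℝ) : ℝ :=
  iteratedDeriv 3 (fun x => g x h) 0

/-- A pitchfork bifurcation from the symmetric branch `X` at `hc` whose outer branches exist for
parameters in `side` (one of the two open half-lines at `hc`). In a fixed uniform neighbourhood of
`X hc`: for `h` in `side` close to `hc` there are exactly three `1`-periodic solutions, the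
symmetric one `X h` and two non-symmetric ones `Y h`, `R (Y h)` (distinct, as `Y h` is not fixed
by `R`), which depend continuously on `h`, have property `S`, and merge with `X hc` as `h → hc`;
for all other `h` close to `hc`, including `hc` itself, `X h` is the only one. -/
def IsPitchfork (f : ℝ → ℝ) (hc : ℝ) (X : ℝ → ℝ → ℝ) (side : Set ℝ)
    (S : ℝ → (ℝ → ℝ) → Prop) : Prop :=
  ∃ r > 0, ∃ Y : ℝ → ℝ → ℝ,
    (∀ᶠ h in 𝓝[side] hc,
      reflect (Y h) ≠ Y h ∧
      {x | IsPeriodicSolution f h x ∧ Near r x (X hc)} = {X h, Y h, reflect (Y h)} ∧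
      (∀ ε > 0, ∀ᶠ k in 𝓝 h, Near ε (Y k) (Y h)) ∧
      S h (Y h) ∧ S h (reflect (Y h))) ∧
    (∀ ε > 0, ∀ᶠ h in 𝓝[side] hc, Near ε (Y h) (X hc)) ∧
    (∀ᶠ h in 𝓝[sideᶜ] hc, {x | IsPeriodicSolution f h x ∧ Near r x (X hc)} = {X h})

/-- Subcritical pitchfork: three solutions for `h < hc`, the outer two stable, merge into one. -/
def IsSubcriticalPitchfork (f : ℝ → ℝ) (hc : ℝ) (X : ℝ → ℝ → ℝ) : Prop :=
  IsPitchfork f hc X (Set.Iio hc) (fun h x => IsStable f h x)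

/-- Supercritical pitchfork: two unstable solutions are emitted and exist for `h > hc`. -/
def IsSupercriticalPitchfork (f : ℝ → ℝ) (hc : ℝ) (X : ℝ → ℝ → ℝ) : Prop :=
  IsPitchfork f hc X (Set.Ioi hc) (fun h x => ¬ IsStable f h x)

end PeriodicBistable

/-!
The periodic solutions of `x' = f(x) + h cos(2πt)` near the critical solution `x₀` are found by a
Lyapunov–Schmidt reduction carried out on the circle. Writing `u = x₀ + v z`, the equation with a
multiple of `v*` added,
`u' = f(u) + h cos(2πt) + β v*`, turns into `z' = M z + (h - hc) v* cos(2πt) + β (v*)²`, where the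
remainder `M` vanishes to second order at `0`. Let `T` be the bounded operator that solves
`y' = φ - (∫ φ / ∫ (v*)²) (v*)²` periodically with `∫ v² y = 0` (`periodicSolver`). Then the
equation says that `Θ z = z - T (M z)` equals `x + (h - hc) T (v* cos)`, where `x` is the coordinate
of `u - x₀` along `v` (`IsCritical.reducedMap_eq_iff`). Superposition operators of `C³` functions
are `C³` on continuous functions (`contDiff_postcomp`), so `Θ` is `C³`, and its derivative at `0` is
the identity. The inverse function theorem gives a family `u x h` with `Φ(u x h, h)` a multiple of
`v*`, the multiple being the `C³` reduced function `g` up to normalisation; the family is locally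
unique and strictly increasing in `x` (`ReducedFamily`). Uniqueness shows that all reduced functions
agree near `(0, hc)`, that `g` is odd in `x`, and that the symmetric branch is `x = 0`.

Stability is read off from the sign of `g` without linearisation. Where `g ≥ 0`, the function
`u x h` is a supersolution of the equation, and where `g ≤ 0` it is a subsolution. Hence a zero of
`g(·, h)` at which the sign changes from minus to plus gives a stable solution
(`ReducedFamily.isStable`). If `g(·, h)` is negative just above a zero, then sliding slowly up the
family produces moving subsolutions which drive nearby solutions away, and the solution at the zero
is unstable (`ReducedFamily.not_isStable`).

Suppose that `σ g_xxx(0, hc) > 0` with `σ = ±1`. As `g` is odd in `x`, the functions `σ g(·, h)` are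
strictly convex on a common interval `[0, η]` and vanish at `0`
(`exists_strictConvexOn_of_odd`). Such a function is either positive on `(0, η)`, or
negative near `0` with at most one positive zero. The stability of the symmetric branch decides
which of the two cases occurs on each side of `hc`, and passing to the limit decides the case
`h = hc`. On one side there is thus no positive zero; on the other there is exactly one, which is
continuous in `h` and tends to `0` (`exists_zero_branch`). Oddness gives the negative zero, that is,
the reflected solution, and the sign change of `g` at the zero gives the stability of the outer
branches (`ReducedFamily.isPitchfork`).
-/

namespace PeriodicBistable

/-! ### The superposition operator on continuous functions -/

section Superposition

variable {K : Type*} [TopologicalSpace K] [CompactSpace K]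

/-- The superposition operator `u ↦ φ ∘ u` of a `C¹` function `φ` is differentiable for the uniform
norm, and its derivative at `u` is multiplication by `φ' ∘ u`. -/
theorem hasFDerivAt_postcomp (φ ψ : C(ℝ, ℝ)) (hφ : ∀ s, HasDerivAt φ (ψ s) s) (u : C(K, ℝ)) :
    HasFDerivAt (fun w : C(K, ℝ) => φ.comp w)
      (ContinuousLinearMap.mul ℝ C(K, ℝ) (ψ.comp u)) u := by
  rw [hasFDerivAt_iff_isLittleO_nhds_zero, Asymptotics.isLittleO_iff]
  intro c hc
  have hcont : Continuous (fun w : C(K, ℝ) => ψ.comp w) := ContinuousMap.continuous_postcomp ψ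
  obtain ⟨δ, hδ, hball⟩ := Metric.continuousAt_iff.1 (hcont.continuousAt (x := u)) c hc
  filter_upwards [Metric.ball_mem_nhds (0 : C(K, ℝ)) hδ] with h hh
  rw [mem_ball_zero_iff] at hh
  refine (ContinuousMap.norm_le _ (by positivity)).2 fun t => ?_
  have hderiv : ∀ θ ∈ Set.Icc (0 : ℝ) 1, HasDerivWithinAt
      (fun θ : ℝ => φ (u t + θ * h t) - ψ (u t) * (θ * h t))
      ((ψ (u t + θ * h t) - ψ (u t)) * h t) (Set.Icc 0 1) θ := by
    intro θ _
    have h1 : HasDerivAt (fun θ : ℝ => θ * h t) (h t) θ := by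
      simpa using (hasDerivAt_id θ).mul_const (h t)
    have h2 := (hφ (u t + θ * h t)).comp θ (h1.const_add (u t))
    have h3 := h2.sub (h1.const_mul (ψ (u t)))
    refine (h3.congr_deriv ?_).hasDerivWithinAt
    ring
  have hbound : ∀ θ ∈ Set.Ico (0 : ℝ) 1,
      ‖(ψ (u t + θ * h t) - ψ (u t)) * h t‖ ≤ c * ‖h‖ := by
    intro θ hθ
    rw [norm_mul]
    refine mul_le_mul ?_ (h.norm_coe_le_norm t) (norm_nonneg _) hc.le
    have h1 : dist (u + θ • h) u < δ := by
      rw [dist_eq_norm, add_sub_cancel_left, norm_smul, Real.norm_of_nonneg hθ.1]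
      exact (mul_le_of_le_one_left (norm_nonneg _) hθ.2.le).trans_lt hh
    have h2 := (ContinuousMap.dist_apply_le_dist t).trans (hball h1).le
    simpa [Real.dist_eq] using h2
  have := norm_image_sub_le_of_norm_deriv_le_segment_01' hderiv hbound
  simpa [sub_right_comm] using this

theorem contDiff_postcomp (n : ℕ) (φ : C(ℝ, ℝ)) (hφ : ContDiff ℝ n φ) :
    ContDiff ℝ n (fun w : C(K, ℝ) => φ.comp w) := by
  induction n generalizing φ with
  | zero => exact contDiff_zero.2 (ContinuousMap.continuous_postcomp φ)
  | succ n ih =>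
    have hφ' := contDiff_succ_iff_deriv.1 (by exact_mod_cast hφ : ContDiff ℝ ((n : ℕ∞) + 1) φ)
    obtain ⟨hd, -, hd'⟩ := hφ'
    let ψ : C(ℝ, ℝ) := ⟨deriv φ, hd'.continuous⟩
    have key : ContDiff ℝ (n + 1) (fun w : C(K, ℝ) => φ.comp w) := by
      refine contDiff_succ_iff_hasFDerivAt.2
        ⟨fun w => ContinuousLinearMap.mul ℝ C(K, ℝ) (ψ.comp w), ?_, ?_⟩
      · exact (ContinuousLinearMap.contDiff (𝕜 := ℝ) (E := C(K, ℝ)) (F := C(K, ℝ) →L[ℝ] C(K, ℝ))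
          (ContinuousLinearMap.mul ℝ C(K, ℝ))).comp (ih ψ hd')
      · exact hasFDerivAt_postcomp φ ψ fun s => (hd s).hasDerivAt
    exact_mod_cast key

end Superposition

/-! ### Continuous functions on the circle -/

/-- A continuous `1`-periodic function, as a continuous function on the circle `ℝ / ℤ`. -/
noncomputable def circleLift (x : ℝ → ℝ) (hx : Continuous x) (hp : Function.Periodic x 1) :
    C(UnitAddCircle, ℝ) :=
  ⟨hp.lift, continuous_coinduced_dom.2 hx⟩

@[simp]
theorem circleLift_coe (x : ℝ → ℝ) (hx : Continuous x) (hp : Function.Periodic x 1) (t : ℝ) :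
    circleLift x hx hp (t : UnitAddCircle) = x t :=
  hp.lift_coe t

theorem continuous_coe_circle (z : C(UnitAddCircle, ℝ)) :
    Continuous (fun t : ℝ => z (t : UnitAddCircle)) :=
  z.continuous.comp continuous_quotient_mk'

theorem continuous_coe_circle_sub_const (z : C(UnitAddCircle, ℝ)) (c : ℝ) :
    Continuous (fun t : ℝ => z (t : UnitAddCircle) - c) :=
  (continuous_coe_circle z).sub continuous_const

theorem periodic_coe_circle (z : C(UnitAddCircle, ℝ)) :
    Function.Periodic (fun t : ℝ => z (t : UnitAddCircle)) 1 := fun t => by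
  simp only [AddCircle.coe_add_period]

theorem circle_ext {z w : C(UnitAddCircle, ℝ)} (h : ∀ t : ℝ, z t = w t) : z = w := by
  ext c
  induction c using QuotientAddGroup.induction_on with
  | H t => exact h t

theorem circle_norm_le {z : C(UnitAddCircle, ℝ)} {B : ℝ} (hB : 0 ≤ B)
    (h : ∀ t ∈ Set.Ico (0 : ℝ) 1, |z t| ≤ B) : ‖z‖ ≤ B := by
  refine (ContinuousMap.norm_le _ hB).2 fun c => ?_
  obtain ⟨t, ht, rfl⟩ := AddCircle.eq_coe_Ico c
  exact h t ht

theorem abs_coe_circle_le (z : C(UnitAddCircle, ℝ)) (t : ℝ) : |z t| ≤ ‖z‖ :=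
  z.norm_coe_le_norm t

theorem intervalIntegrable_coe_circle (z : C(UnitAddCircle, ℝ)) (a b : ℝ) :
    IntervalIntegrable (fun t : ℝ => z t) MeasureTheory.volume a b :=
  (continuous_coe_circle z).intervalIntegrable a b

/-- The mean `z ↦ ∫₀¹ z`, as a continuous linear functional. -/
noncomputable def circleMean : C(UnitAddCircle, ℝ) →L[ℝ] ℝ :=
  LinearMap.mkContinuous
    { toFun := fun z => ∫ t in (0 : ℝ)..1, z (t : UnitAddCircle)
      map_add' := fun z w => by
        simpa using intervalIntegral.integral_add (intervalIntegrable_coe_circle z 0 1)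
          (intervalIntegrable_coe_circle w 0 1)
      map_smul' := fun c z => by simp } 1 fun z => by
    simpa using intervalIntegral.norm_integral_le_of_norm_le_const (a := (0 : ℝ)) (b := 1)
      (f := fun t : ℝ => z (t : UnitAddCircle)) (C := ‖z‖) fun t _ => z.norm_coe_le_norm t

theorem circleMean_apply (z : C(UnitAddCircle, ℝ)) :
    circleMean z = ∫ t in (0 : ℝ)..1, z (t : UnitAddCircle) := rfl

theorem circleMean_pos {z : C(UnitAddCircle, ℝ)} (hz : ∀ t : ℝ, 0 < z t) : 0 < circleMean z :=
  intervalIntegral.intervalIntegral_pos_of_pos (intervalIntegrable_coe_circle z 0 1) hz one_pos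

/-- The primitive of `z - ∫₀¹ z` that vanishes at `0`. -/
noncomputable def circlePrimitiveFun (z : C(UnitAddCircle, ℝ)) : C(UnitAddCircle, ℝ) :=
  circleLift (fun t => ∫ s in (0 : ℝ)..t, (z (s : UnitAddCircle) - circleMean z))
    (intervalIntegral.continuous_primitive
      (fun a b => (continuous_coe_circle_sub_const z _).intervalIntegrable a b) 0)
    fun t => by
      have hper : Function.Periodic (fun s : ℝ => z (s : UnitAddCircle) - circleMean z) 1 :=
        fun s => by simp only [AddCircle.coe_add_period]
      have hint : ∀ a b : ℝ, IntervalIntegrable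
          (fun s : ℝ => z (s : UnitAddCircle) - circleMean z) MeasureTheory.volume a b :=
        fun a b => (continuous_coe_circle_sub_const z _).intervalIntegrable a b
      change ∫ s in (0 : ℝ)..(t + 1), (z (s : UnitAddCircle) - circleMean z) =
        ∫ s in (0 : ℝ)..t, (z (s : UnitAddCircle) - circleMean z)
      rw [← intervalIntegral.integral_add_adjacent_intervals (hint 0 t) (hint t (t + 1)),
        hper.intervalIntegral_add_eq t 0, zero_add,
        intervalIntegral.integral_sub (intervalIntegrable_coe_circle z 0 1) (by simp),
        ← circleMean_apply]
      simp

theorem circlePrimitiveFun_coe (z : C(UnitAddCircle, ℝ)) (t : ℝ) :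
    circlePrimitiveFun z t = ∫ s in (0 : ℝ)..t, (z (s : UnitAddCircle) - circleMean z) :=
  circleLift_coe _ _ _ _

/-- The primitive of `z - ∫₀¹ z` that vanishes at `0`, as a bounded linear operator. -/
noncomputable def circlePrimitive : C(UnitAddCircle, ℝ) →L[ℝ] C(UnitAddCircle, ℝ) :=
  LinearMap.mkContinuous
    { toFun := circlePrimitiveFun
      map_add' := fun z w => circle_ext fun t => by
        simp only [ContinuousMap.add_apply, circlePrimitiveFun_coe, map_add]
        rw [← intervalIntegral.integral_add
          ((continuous_coe_circle_sub_const z _).intervalIntegrable 0 t)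
          ((continuous_coe_circle_sub_const w _).intervalIntegrable 0 t)]
        congr 1; ext s; ring
      map_smul' := fun c z => circle_ext fun t => by
        simp only [ContinuousMap.smul_apply, circlePrimitiveFun_coe, map_smul, RingHom.id_apply,
          smul_eq_mul]
        rw [← intervalIntegral.integral_const_mul]
        congr 1; ext s; ring } (1 + ‖circleMean‖) fun z => by
    refine circle_norm_le (by positivity) fun t ht => ?_
    have h := intervalIntegral.norm_integral_le_of_norm_le_const (a := (0 : ℝ)) (b := t)
      (f := fun s : ℝ => z (s : UnitAddCircle) - circleMean z) (C := (1 + ‖circleMean‖) * ‖z‖)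
      fun s _ => by
        rw [add_mul, one_mul]
        exact (norm_sub_le _ _).trans
          (add_le_add (z.norm_coe_le_norm s) (circleMean.le_opNorm z))
    simp only [LinearMap.coe_mk, AddHom.coe_mk, circlePrimitiveFun_coe]
    refine h.trans (mul_le_of_le_one_right (by positivity) ?_)
    rw [sub_zero, abs_of_nonneg ht.1]
    exact ht.2.le

theorem hasDerivAt_circlePrimitive (z : C(UnitAddCircle, ℝ)) (t : ℝ) :
    HasDerivAt (fun t : ℝ => circlePrimitive z t) (z t - circleMean z) t := by
  have h : (fun t : ℝ => circlePrimitive z t) =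
      fun t => ∫ s in (0 : ℝ)..t, (z (s : UnitAddCircle) - circleMean z) :=
    funext fun t => circlePrimitiveFun_coe z t
  rw [h]
  exact intervalIntegral.integral_hasDerivAt_right
    ((continuous_coe_circle_sub_const z _).intervalIntegrable 0 t)
    ((continuous_coe_circle_sub_const z _).stronglyMeasurableAtFilter _ _)
    (continuous_coe_circle_sub_const z _).continuousAt

/-- The bounded operator sending `φ` to the periodic solution `y` of
`y' = φ - (∫ φ / ∫ ω) ω`, normalised by `∫ ρ y = 0`. -/
noncomputable def periodicSolver (ω ρ : C(UnitAddCircle, ℝ)) :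
    C(UnitAddCircle, ℝ) →L[ℝ] C(UnitAddCircle, ℝ) :=
  let S := circlePrimitive ∘L
    (ContinuousLinearMap.id ℝ _ - ((circleMean ω)⁻¹ • circleMean).smulRight ω)
  S - (((circleMean ρ)⁻¹ • circleMean ∘L ContinuousLinearMap.mul ℝ _ ρ) ∘L S).smulRight 1

theorem hasDerivAt_periodicSolver {ω : C(UnitAddCircle, ℝ)} (hω : circleMean ω ≠ 0)
    (ρ φ : C(UnitAddCircle, ℝ)) (t : ℝ) :
    HasDerivAt (fun t : ℝ => periodicSolver ω ρ φ t)
      (φ t - circleMean φ / circleMean ω * ω t) t := by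
  have h := hasDerivAt_circlePrimitive (φ - ((circleMean ω)⁻¹ * circleMean φ) • ω) t
  have h2 := h.sub_const
    ((circleMean ρ)⁻¹ *
      circleMean (ρ * circlePrimitive (φ - ((circleMean ω)⁻¹ * circleMean φ) • ω)))
  refine (h2.congr_deriv ?_).congr_of_eventuallyEq (Eventually.of_forall fun s => ?_)
  · simp only [map_sub, map_smul, smul_eq_mul, ContinuousMap.sub_apply, ContinuousMap.smul_apply]
    field_simp
    ring
  · simp only [periodicSolver, sub_apply, ContinuousLinearMap.comp_apply,
      ContinuousLinearMap.smulRight_apply, smul_apply,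
      ContinuousLinearMap.id_apply, ContinuousLinearMap.mul_apply', ContinuousMap.sub_apply,
      ContinuousMap.smul_apply, ContinuousMap.one_apply, smul_eq_mul, mul_one]

theorem circleMean_mul_periodicSolver {ρ : C(UnitAddCircle, ℝ)} (hρ : circleMean ρ ≠ 0)
    (ω φ : C(UnitAddCircle, ℝ)) : circleMean (ρ * periodicSolver ω ρ φ) = 0 := by
  simp only [periodicSolver, sub_apply, ContinuousLinearMap.comp_apply,
    ContinuousLinearMap.smulRight_apply, smul_apply,
    ContinuousLinearMap.id_apply, ContinuousLinearMap.mul_apply', smul_eq_mul]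
  rw [mul_sub, map_sub, mul_smul_comm, mul_one, map_smul, smul_eq_mul]
  field_simp
  ring

theorem eq_add_smul_one_of_hasDerivAt {z w : C(UnitAddCircle, ℝ)} {d : ℝ → ℝ}
    (hz : ∀ t : ℝ, HasDerivAt (fun t : ℝ => z t) (d t) t)
    (hw : ∀ t : ℝ, HasDerivAt (fun t : ℝ => w t) (d t) t) : ∃ c : ℝ, z = c • 1 + w := by
  refine ⟨z (0 : ℝ) - w (0 : ℝ), circle_ext fun t => ?_⟩
  have h := is_const_of_deriv_eq_zero (f := fun t : ℝ => z t - w t)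
    (fun t => ((hz t).sub (hw t)).differentiableAt)
    (fun t => ((hz t).sub (hw t)).deriv.trans (sub_self _)) t 0
  simp only [ContinuousMap.add_apply, ContinuousMap.smul_apply, ContinuousMap.one_apply,
    smul_eq_mul, mul_one]
  linarith

theorem eq_smul_one_add_periodicSolver_iff {ω ρ : C(UnitAddCircle, ℝ)} (hω : circleMean ω ≠ 0)
    (hρ : circleMean ρ ≠ 0) (z φ : C(UnitAddCircle, ℝ)) (x : ℝ) :
    z = x • 1 + periodicSolver ω ρ φ ↔
      (∀ t : ℝ, HasDerivAt (fun t : ℝ => z t) (φ t - circleMean φ / circleMean ω * ω t) t) ∧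
        circleMean (ρ * z) = x * circleMean ρ := by
  have hmean : ∀ c : ℝ, circleMean (ρ * (c • 1 + periodicSolver ω ρ φ)) = c * circleMean ρ := by
    intro c
    rw [mul_add, map_add, circleMean_mul_periodicSolver hρ, mul_smul_comm, mul_one, map_smul,
      smul_eq_mul, add_zero]
  constructor
  · rintro rfl
    refine ⟨fun t => ?_, hmean x⟩
    refine ((hasDerivAt_periodicSolver hω ρ φ t).const_add x).congr_of_eventuallyEq
      (Eventually.of_forall fun s => by simp)
  · rintro ⟨hz, hm⟩
    obtain ⟨c, rfl⟩ := eq_add_smul_one_of_hasDerivAt hz (hasDerivAt_periodicSolver hω ρ φ)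
    rw [hmean] at hm
    rw [mul_right_cancel₀ hρ hm]

/-! ### Comparison, stability and instability for scalar equations -/

/-- Comparison principle: a subsolution of `y' = F(y) + p(t)` that starts below a supersolution
stays below it. -/
theorem le_of_subsolution_of_supersolution {F : ℝ → ℝ} {K : NNReal} {s : Set ℝ}
    (hF : LipschitzOnWith K F s) {p a a' b b' : ℝ → ℝ} {T : ℝ}
    (ha : ContinuousOn a (Set.Icc 0 T))
    (ha' : ∀ t ∈ Set.Ico 0 T, HasDerivWithinAt a (a' t) (Set.Ici t) t)
    (hb : ContinuousOn b (Set.Icc 0 T))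
    (hb' : ∀ t ∈ Set.Ico 0 T, HasDerivWithinAt b (b' t) (Set.Ici t) t)
    (has : ∀ t ∈ Set.Ico 0 T, a t ∈ s) (hbs : ∀ t ∈ Set.Ico 0 T, b t ∈ s)
    (hsub : ∀ t ∈ Set.Ico 0 T, a' t ≤ F (a t) + p t)
    (hsup : ∀ t ∈ Set.Ico 0 T, F (b t) + p t ≤ b' t)
    (h0 : a 0 ≤ b 0) : ∀ t ∈ Set.Icc 0 T, a t ≤ b t := by
  -- Adding `ε e^{(K+1)t}` to `b` makes it a strict supersolution.
  have key : ∀ ε > 0, ∀ t ∈ Set.Icc 0 T, a t ≤ b t + ε * Real.exp ((K + 1) * t) := by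
    intro ε hε
    have hE : ∀ t : ℝ, HasDerivAt (fun t : ℝ => ε * Real.exp ((K + 1) * t))
        (ε * (Real.exp ((K + 1) * t) * (K + 1))) t := by
      intro t
      have h1 : HasDerivAt (fun t : ℝ => ((K : ℝ) + 1) * t) (K + 1) t := by
        simpa using (hasDerivAt_id t).const_mul ((K : ℝ) + 1)
      exact h1.exp.const_mul ε
    have hEc : Continuous (fun t : ℝ => ε * Real.exp ((K + 1) * t)) := by fun_prop
    refine image_le_of_deriv_right_lt_deriv_boundary' ha ha' ?_
      (hb.add hEc.continuousOn) (fun t ht => (hb' t ht).add (hE t).hasDerivWithinAt) ?_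
    · have : 0 ≤ ε * Real.exp ((K + 1) * 0) := by positivity
      linarith
    · intro t ht heq
      have hpos : 0 < ε * Real.exp ((K + 1) * t) := by positivity
      have hLip := hF.dist_le_mul _ (has t ht) _ (hbs t ht)
      rw [Real.dist_eq, Real.dist_eq] at hLip
      have hab : a t - b t = ε * Real.exp ((K + 1) * t) := by
        have : a t = b t + ε * Real.exp ((K + 1) * t) := heq
        linarith
      rw [hab, abs_of_pos hpos] at hLip
      have h1 := le_abs_self (F (a t) - F (b t))
      have h2 := hsub t ht
      have h3 := hsup t ht
      nlinarith
  intro t ht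
  refine le_of_forall_pos_le_add fun ε hε => ?_
  have h := key (ε / Real.exp ((K + 1) * t)) (by positivity) t ht
  rwa [div_mul_cancel₀ _ (Real.exp_pos _).ne'] at h

theorem exists_lipschitzOnWith_Icc {f : ℝ → ℝ} (hf : ContDiff ℝ 1 f) (B : ℝ) :
    ∃ K, LipschitzOnWith K f (Set.Icc (-B) B) :=
  hf.contDiffOn.exists_lipschitzOnWith one_ne_zero (convex_Icc _ _) isCompact_Icc

/-- Global existence for a bounded globally Lipschitz field with bounded continuous forcing. -/
theorem exists_solution_of_bounded {F : ℝ → ℝ} {K : NNReal} (hF : LipschitzWith K F) {L : ℝ}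
    (hL : ∀ s, |F s| ≤ L) {p : ℝ → ℝ} (hp : Continuous p) {M : ℝ} (hM : ∀ t, |p t| ≤ M)
    (y₀ : ℝ) {T : ℝ} (hT : 0 ≤ T) :
    ∃ y : ℝ → ℝ, y 0 = y₀ ∧
      ∀ t ∈ Set.Icc 0 T, HasDerivWithinAt y (F (y t) + p t) (Set.Icc 0 T) t := by
  have hL0 : 0 ≤ L := (abs_nonneg _).trans (hL 0)
  have hM0 : 0 ≤ M := (abs_nonneg _).trans (hM 0)
  have hpl : IsPicardLindelof (fun t y => F y + p t) (tmin := 0) (tmax := T)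
      ⟨0, Set.left_mem_Icc.2 hT⟩ y₀ (⟨(L + M) * T, by positivity⟩ : NNReal) 0
      (⟨L + M, by positivity⟩ : NNReal) K :=
    { lipschitzOnWith := fun t _ => by
        refine LipschitzWith.lipschitzOnWith (LipschitzWith.of_dist_le_mul fun a b => ?_)
        rw [dist_add_right]
        exact hF.dist_le_mul a b
      continuousOn := fun y _ => by fun_prop
      norm_le := fun t _ y _ => (norm_add_le _ _).trans (add_le_add (hL y) (hM t))
      mul_max_le := by
        change (L + M) * max (T - 0) (0 - 0) ≤ (L + M) * T - 0
        simp [hT] }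
  obtain ⟨y, hy0, hy⟩ := hpl.exists_eq_forall_mem_Icc_hasDerivWithinAt₀
  exact ⟨y, hy0, hy⟩

theorem hasDerivWithinAt_Ici_of_Icc {y : ℝ → ℝ} {d T t : ℝ}
    (h : HasDerivWithinAt y d (Set.Icc 0 T) t) (ht : t ∈ Set.Ico 0 T) :
    HasDerivWithinAt y d (Set.Ici t) t :=
  h.mono_of_mem_nhdsWithin (Icc_mem_nhdsGE_of_mem ht)

theorem exists_abs_le_of_continuousOn_Icc {y : ℝ → ℝ} {T : ℝ} (hy : ContinuousOn y (Set.Icc 0 T)) :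
    ∃ B, ∀ t ∈ Set.Icc 0 T, |y t| ≤ B :=
  isCompact_Icc.exists_bound_of_continuousOn hy

/-- A solution enclosed by arbitrarily close sub- and supersolutions is stable. -/
theorem isStable_of_barriers {f : ℝ → ℝ} (hf : ContDiff ℝ 1 f) {h : ℝ} {x : ℝ → ℝ}
    (hl : ∀ ε > 0, ∃ l l' : ℝ → ℝ, (∀ t, HasDerivAt l (l' t) t) ∧
      (∀ t, l' t ≤ f (l t) + h * Real.cos (2 * Real.pi * t)) ∧ l 0 < x 0 ∧ ∀ t, x t - ε < l t)
    (hu : ∀ ε > 0, ∃ u u' : ℝ → ℝ, (∀ t, HasDerivAt u (u' t) t) ∧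
      (∀ t, f (u t) + h * Real.cos (2 * Real.pi * t) ≤ u' t) ∧ x 0 < u 0 ∧ ∀ t, u t < x t + ε) :
    IsStable f h x := by
  intro ε hε
  obtain ⟨l, l', hl1, hl2, hl3, hl4⟩ := hl ε hε
  obtain ⟨u, u', hu1, hu2, hu3, hu4⟩ := hu ε hε
  refine ⟨min (x 0 - l 0) (u 0 - x 0), lt_min (by linarith) (by linarith), ?_⟩
  intro T y hy hy0 t ht
  have hy0' := abs_lt.1 hy0
  have hle1 := min_le_left (x 0 - l 0) (u 0 - x 0)
  have hle2 := min_le_right (x 0 - l 0) (u 0 - x 0)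
  have hlc : ContinuousOn l (Set.Icc 0 T) := fun t _ => (hl1 t).continuousAt.continuousWithinAt
  have huc : ContinuousOn u (Set.Icc 0 T) := fun t _ => (hu1 t).continuousAt.continuousWithinAt
  have hyc : ContinuousOn y (Set.Icc 0 T) := fun t ht => (hy t ht).continuousWithinAt
  obtain ⟨B1, hB1⟩ := exists_abs_le_of_continuousOn_Icc hlc
  obtain ⟨B2, hB2⟩ := exists_abs_le_of_continuousOn_Icc huc
  obtain ⟨B3, hB3⟩ := exists_abs_le_of_continuousOn_Icc hyc
  set B := max B1 (max B2 B3)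
  obtain ⟨K, hK⟩ := exists_lipschitzOnWith_Icc hf B
  have hIco : ∀ t ∈ Set.Ico 0 T, t ∈ Set.Icc 0 T := fun t ht => Set.Ico_subset_Icc_self ht
  have hmem1 : ∀ t ∈ Set.Ico 0 T, l t ∈ Set.Icc (-B) B := fun t ht =>
    abs_le.1 ((hB1 t (hIco t ht)).trans (le_max_left _ _))
  have hmem2 : ∀ t ∈ Set.Ico 0 T, u t ∈ Set.Icc (-B) B := fun t ht =>
    abs_le.1 ((hB2 t (hIco t ht)).trans ((le_max_left _ _).trans (le_max_right _ _)))
  have hmem3 : ∀ t ∈ Set.Ico 0 T, y t ∈ Set.Icc (-B) B := fun t ht =>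
    abs_le.1 ((hB3 t (hIco t ht)).trans ((le_max_right _ _).trans (le_max_right _ _)))
  have hyd := fun t ht => hasDerivWithinAt_Ici_of_Icc (hy t (hIco t ht)) ht
  have c1 := le_of_subsolution_of_supersolution hK hlc (fun t _ => (hl1 t).hasDerivWithinAt) hyc
    hyd hmem1 hmem3 (fun t _ => hl2 t) (fun t _ => le_rfl) (by linarith) t ht
  have c2 := le_of_subsolution_of_supersolution hK hyc hyd huc
    (fun t _ => (hu1 t).hasDerivWithinAt) hmem3 hmem2 (fun t _ => le_rfl) (fun t _ => hu2 t)
    (by linarith) t ht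
  have c3 := hl4 t
  have c4 := hu4 t
  exact abs_lt.2 ⟨by linarith, by linarith⟩

/-- If subsolutions that start arbitrarily close to `x` climb a fixed height above `x`, then `x` is
unstable. The solutions they push upwards are those of the equation in which `f` is frozen outside
a large interval, so that they exist for as long as needed. -/
theorem not_isStable_of_subsolutions {f : ℝ → ℝ} (hf : ContDiff ℝ 1 f) {h : ℝ} {x : ℝ → ℝ}
    (hx : Continuous x) {ε : ℝ} (hε : 0 < ε)
    (H : ∀ δ > 0, ∃ T ≥ 0, ∃ z z' : ℝ → ℝ, (∀ t ∈ Set.Icc 0 T, HasDerivAt z (z' t) t) ∧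
      (∀ t ∈ Set.Icc 0 T, z' t ≤ f (z t) + h * Real.cos (2 * Real.pi * t)) ∧
      |z 0 - x 0| < δ ∧ x T + ε ≤ z T) : ¬ IsStable f h x := by
  intro hs
  obtain ⟨δ, hδ, hstab⟩ := hs ε hε
  obtain ⟨T, hT, z, z', hz1, hz2, hz3, hz4⟩ := H (min δ ε) (lt_min hδ hε)
  have hzc : ContinuousOn z (Set.Icc 0 T) := fun t ht => (hz1 t ht).continuousAt.continuousWithinAt
  obtain ⟨B1, hB1⟩ := exists_abs_le_of_continuousOn_Icc hzc
  obtain ⟨B2, hB2⟩ := exists_abs_le_of_continuousOn_Icc (T := T) hx.continuousOn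
  set B := max B1 (B2 + ε)
  have hB0 : 0 ≤ B :=
    (abs_nonneg _).trans ((hB1 0 (Set.left_mem_Icc.2 hT)).trans (le_max_left _ _))
  have hBB : -B ≤ B := by linarith
  obtain ⟨K, hK⟩ := exists_lipschitzOnWith_Icc hf B
  let F : ℝ → ℝ := Set.IccExtend hBB ((Set.Icc (-B) B).domRestrict f)
  have hFeq : ∀ s, |s| ≤ B → F s = f s := fun s hs =>
    Set.IccExtend_of_mem hBB _ (abs_le.1 hs)
  have hFL : LipschitzWith (K * 1) F :=
    (lipschitzOnWith_iff_restrict.1 hK).comp (LipschitzWith.projIcc hBB)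
  obtain ⟨L, hL⟩ := (isCompact_Icc (a := -B) (b := B)).exists_bound_of_continuousOn
    hf.continuous.continuousOn
  let p : ℝ → ℝ := fun t => h * Real.cos (2 * Real.pi * t)
  have hp : Continuous p := by fun_prop
  have hpM : ∀ t, |p t| ≤ |h| := fun t => by
    rw [abs_mul]
    exact mul_le_of_le_one_right (abs_nonneg _) (Real.abs_cos_le_one _)
  obtain ⟨y, hy0, hy⟩ := exists_solution_of_bounded hFL
    (fun s => hL _ (Set.projIcc (-B) B hBB s).2) hp hpM (z 0) hT
  have hyc : ContinuousOn y (Set.Icc 0 T) := fun t ht => (hy t ht).continuousWithinAt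
  have hIco : ∀ t ∈ Set.Ico 0 T, t ∈ Set.Icc 0 T := fun t ht => Set.Ico_subset_Icc_self ht
  have hzy : ∀ t ∈ Set.Icc 0 T, z t ≤ y t := by
    refine le_of_subsolution_of_supersolution (hFL.lipschitzOnWith (s := Set.univ)) hzc
      (fun t ht => (hz1 t (hIco t ht)).hasDerivWithinAt) hyc
      (fun t ht => hasDerivWithinAt_Ici_of_Icc (hy t (hIco t ht)) ht) (fun _ _ => trivial)
      (fun _ _ => trivial) (fun t ht => ?_) (fun t _ => le_rfl) hy0.ge
    rw [hFeq _ ((hB1 t (hIco t ht)).trans (le_max_left _ _))]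
    exact hz2 t (hIco t ht)
  -- The frozen solution leaves the `ε`-tube around `x`; up to the first exit it solves the
  -- original equation.
  have hne : (Set.Icc 0 T ∩ {t | ε ≤ |y t - x t|}).Nonempty := by
    refine ⟨T, Set.right_mem_Icc.2 hT, ?_⟩
    have := hzy T (Set.right_mem_Icc.2 hT)
    exact le_trans (by linarith) (le_abs_self (y T - x T))
  have hcomp : IsCompact (Set.Icc 0 T ∩ {t | ε ≤ |y t - x t|}) := by
    refine isCompact_Icc.of_isClosed_subset ?_ Set.inter_subset_left
    exact (hyc.sub hx.continuousOn).abs.preimage_isClosed_of_isClosed isClosed_Icc isClosed_Ici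
  obtain ⟨t₁, ⟨ht₁, hexit⟩, hleast⟩ := hcomp.exists_isLeast hne
  have hstart : |y 0 - x 0| < min δ ε := by rwa [hy0]
  have hpos : 0 < t₁ := by
    refine ht₁.1.lt_of_ne fun h0 => ?_
    rw [← h0] at hexit
    exact absurd hexit (not_le.2 (hstart.trans_le (min_le_right _ _)))
  have hsub : Set.Icc 0 t₁ ⊆ Set.Icc 0 T := Set.Icc_subset_Icc_right ht₁.2
  have hlt : ∀ t ∈ Set.Ico 0 t₁, |y t - x t| ≤ ε := fun t ht => by
    by_contra hcon
    exact absurd (hleast ⟨hsub ⟨ht.1, ht.2.le⟩, (not_le.1 hcon).le⟩) (not_le.2 ht.2)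
  have hle : ∀ t ∈ Set.Icc 0 t₁, |y t - x t| ≤ ε := by
    intro t ht
    have hcl : closure (Set.Ico 0 t₁) = Set.Icc 0 t₁ := closure_Ico hpos.ne
    refine ContinuousWithinAt.closure_le (s := Set.Ico 0 t₁) (hcl ▸ ht)
      (((hyc.sub hx.continuousOn).abs t (hsub ht)).mono
        (Set.Ico_subset_Icc_self.trans hsub)) continuousWithinAt_const hlt
  refine absurd hexit (not_le.2 (hstab t₁ y (fun t ht => ?_)
    (hstart.trans_le (min_le_left _ _)) t₁ (Set.right_mem_Icc.2 hpos.le)))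
  have hyB : |y t| ≤ B := by
    have h1 := hle t ht
    have h2 := hB2 t (hsub ht)
    have h3 := abs_add_le (y t - x t) (x t)
    rw [sub_add_cancel] at h3
    exact (by linarith : |y t| ≤ B2 + ε).trans (le_max_right _ _)
  rw [← hFeq _ hyB]
  exact (hy t (hsub ht)).mono hsub

/-! ### The conjugated equation -/

/-- `x₀` is a `1`-periodic solution at the parameter `hc` whose linearisation has the Floquet
multiplier `1`. -/
structure IsCritical (f : ℝ → ℝ) (hc : ℝ) (x₀ : ℝ → ℝ) : Prop where
  contDiff : ContDiff ℝ 3 f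
  sol : IsPeriodicSolution f hc x₀
  int_eq_zero : (∫ s in (0 : ℝ)..1, deriv f (x₀ s)) = 0

theorem hasDerivAt_of_Phi_eq {f u : ℝ → ℝ} {h b t : ℝ} (hu : IsC1Periodic u)
    (hb : Phi f h u t = b) :
    HasDerivAt u (f (u t) + h * Real.cos (2 * Real.pi * t) + b) t := by
  have h1 := (hu.1.differentiable one_ne_zero t).hasDerivAt
  refine h1.congr_deriv ?_
  rw [← hb, Phi]
  ring

theorem cokerFun_eq_inv (f x₀ : ℝ → ℝ) (t : ℝ) : cokerFun f x₀ t = (kerFun f x₀ t)⁻¹ :=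
  Real.exp_neg _

theorem kerFun_pos (f x₀ : ℝ → ℝ) (t : ℝ) : 0 < kerFun f x₀ t := Real.exp_pos _

theorem cokerFun_pos (f x₀ : ℝ → ℝ) (t : ℝ) : 0 < cokerFun f x₀ t := Real.exp_pos _

theorem periodic_cos_two_pi : Function.Periodic (fun t : ℝ => Real.cos (2 * Real.pi * t)) 1 :=
  fun t => by
    change Real.cos (2 * Real.pi * (t + 1)) = Real.cos (2 * Real.pi * t)
    rw [mul_add, mul_one, Real.cos_add_two_pi]

/-- The forcing `t ↦ cos (2πt)` on the circle. -/
noncomputable def circleCos : C(UnitAddCircle, ℝ) :=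
  circleLift (fun t => Real.cos (2 * Real.pi * t)) (by fun_prop) periodic_cos_two_pi

@[simp]
theorem circleCos_coe (t : ℝ) : circleCos t = Real.cos (2 * Real.pi * t) := circleLift_coe _ _ _ _

namespace IsCritical

variable {f x₀ : ℝ → ℝ} {hc : ℝ}

theorem continuous_deriv (H : IsCritical f hc x₀) : Continuous (deriv f) :=
  H.contDiff.continuous_deriv (by norm_num)

theorem differentiable (H : IsCritical f hc x₀) : Differentiable ℝ f :=
  H.contDiff.differentiable (by norm_num)

theorem continuous (H : IsCritical f hc x₀) : Continuous x₀ := H.sol.1.1.continuous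

theorem periodic (H : IsCritical f hc x₀) : Function.Periodic x₀ 1 := H.sol.1.2

theorem continuous_coeff (H : IsCritical f hc x₀) : Continuous (fun t => deriv f (x₀ t)) :=
  H.continuous_deriv.comp H.continuous

theorem periodic_coeff (H : IsCritical f hc x₀) :
    Function.Periodic (fun t => deriv f (x₀ t)) 1 := fun t => by
  simp only [H.periodic t]

theorem hasDerivAt (H : IsCritical f hc x₀) (t : ℝ) :
    HasDerivAt x₀ (f (x₀ t) + hc * Real.cos (2 * Real.pi * t)) t := by
  simpa using hasDerivAt_of_Phi_eq H.sol.1 (H.sol.2 t)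

theorem hasDerivAt_exponent (H : IsCritical f hc x₀) (t : ℝ) :
    HasDerivAt (fun t => ∫ s in (0 : ℝ)..t, deriv f (x₀ s)) (deriv f (x₀ t)) t :=
  intervalIntegral.integral_hasDerivAt_right (H.continuous_coeff.intervalIntegrable 0 t)
    (H.continuous_coeff.stronglyMeasurableAtFilter _ _) H.continuous_coeff.continuousAt

theorem hasDerivAt_kerFun (H : IsCritical f hc x₀) (t : ℝ) :
    HasDerivAt (kerFun f x₀) (deriv f (x₀ t) * kerFun f x₀ t) t :=
  (H.hasDerivAt_exponent t).exp.congr_deriv (mul_comm _ _)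

theorem hasDerivAt_cokerFun (H : IsCritical f hc x₀) (t : ℝ) :
    HasDerivAt (cokerFun f x₀) (-deriv f (x₀ t) * cokerFun f x₀ t) t :=
  (H.hasDerivAt_exponent t).fun_neg.exp.congr_deriv (mul_comm _ _)

theorem continuous_kerFun (H : IsCritical f hc x₀) : Continuous (kerFun f x₀) :=
  continuous_iff_continuousAt.2 fun t => (H.hasDerivAt_kerFun t).continuousAt

theorem continuous_cokerFun (H : IsCritical f hc x₀) : Continuous (cokerFun f x₀) :=
  continuous_iff_continuousAt.2 fun t => (H.hasDerivAt_cokerFun t).continuousAt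

theorem periodic_kerFun (H : IsCritical f hc x₀) : Function.Periodic (kerFun f x₀) 1 := fun t => by
  have hint := fun a b => H.continuous_coeff.intervalIntegrable (μ := MeasureTheory.volume) a b
  unfold kerFun
  rw [← intervalIntegral.integral_add_adjacent_intervals (hint 0 t) (hint t (t + 1)),
    H.periodic_coeff.intervalIntegral_add_eq t 0, zero_add, H.int_eq_zero, add_zero]

theorem periodic_cokerFun (H : IsCritical f hc x₀) : Function.Periodic (cokerFun f x₀) 1 :=
  fun t => by rw [cokerFun_eq_inv, cokerFun_eq_inv, H.periodic_kerFun]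

/-- `x₀` on the circle. -/
noncomputable def circleSol (H : IsCritical f hc x₀) : C(UnitAddCircle, ℝ) :=
  circleLift x₀ H.continuous H.periodic

/-- `f' ∘ x₀` on the circle. -/
noncomputable def circleCoeff (H : IsCritical f hc x₀) : C(UnitAddCircle, ℝ) :=
  circleLift (fun t => deriv f (x₀ t)) H.continuous_coeff H.periodic_coeff

/-- The kernel function `v` on the circle. -/
noncomputable def circleKer (H : IsCritical f hc x₀) : C(UnitAddCircle, ℝ) :=
  circleLift (kerFun f x₀) H.continuous_kerFun H.periodic_kerFun

/-- The cokernel function `v* = 1 / v` on the circle. -/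
noncomputable def circleCoker (H : IsCritical f hc x₀) : C(UnitAddCircle, ℝ) :=
  circleLift (cokerFun f x₀) H.continuous_cokerFun H.periodic_cokerFun

/-- The nonlinearity `f` as a continuous map. -/
def field (H : IsCritical f hc x₀) : C(ℝ, ℝ) := ⟨f, H.contDiff.continuous⟩

@[simp]
theorem circleSol_coe (H : IsCritical f hc x₀) (t : ℝ) : H.circleSol t = x₀ t :=
  circleLift_coe _ _ _ _

@[simp]
theorem circleCoeff_coe (H : IsCritical f hc x₀) (t : ℝ) : H.circleCoeff t = deriv f (x₀ t) :=
  circleLift_coe _ _ _ _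

@[simp]
theorem circleKer_coe (H : IsCritical f hc x₀) (t : ℝ) : H.circleKer t = kerFun f x₀ t :=
  circleLift_coe _ _ _ _

@[simp]
theorem circleCoker_coe (H : IsCritical f hc x₀) (t : ℝ) : H.circleCoker t = cokerFun f x₀ t :=
  circleLift_coe _ _ _ _

theorem kerFun_le (H : IsCritical f hc x₀) (t : ℝ) : kerFun f x₀ t ≤ ‖H.circleKer‖ := by
  simpa [abs_of_pos (kerFun_pos f x₀ t)] using abs_coe_circle_le H.circleKer t

theorem cokerFun_le (H : IsCritical f hc x₀) (t : ℝ) : cokerFun f x₀ t ≤ ‖H.circleCoker‖ := by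
  simpa [abs_of_pos (cokerFun_pos f x₀ t)] using abs_coe_circle_le H.circleCoker t

theorem le_kerFun (H : IsCritical f hc x₀) (t : ℝ) : ‖H.circleCoker‖⁻¹ ≤ kerFun f x₀ t := by
  have h := H.cokerFun_le t
  rw [cokerFun_eq_inv] at h
  exact inv_le_of_inv_le₀ (kerFun_pos f x₀ t) h

theorem le_cokerFun (H : IsCritical f hc x₀) (t : ℝ) : ‖H.circleKer‖⁻¹ ≤ cokerFun f x₀ t := by
  rw [cokerFun_eq_inv]
  exact inv_anti₀ (kerFun_pos f x₀ t) (H.kerFun_le t)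

/-- The remainder `M z = v* (f(x₀ + v z) - f(x₀) - f'(x₀) v z)`: with `u = x₀ + v z`, the equation
`u' = f(u) + h cos(2πt) + β v*` becomes `z' = M z + (h - hc) v* cos(2πt) + β (v*)²`. -/
noncomputable def remainder (H : IsCritical f hc x₀) (z : C(UnitAddCircle, ℝ)) :
    C(UnitAddCircle, ℝ) :=
  H.circleCoker * (H.field.comp (H.circleSol + H.circleKer * z) - H.field.comp H.circleSol -
    H.circleCoeff * H.circleKer * z)

theorem remainder_coe (H : IsCritical f hc x₀) (z : C(UnitAddCircle, ℝ)) (t : ℝ) :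
    H.remainder z t = cokerFun f x₀ t *
      (f (x₀ t + kerFun f x₀ t * z t) - f (x₀ t) - deriv f (x₀ t) * kerFun f x₀ t * z t) := by
  simp [remainder, field]

theorem contDiff_remainder (H : IsCritical f hc x₀) : ContDiff ℝ 3 H.remainder := by
  have h1 : ContDiff ℝ 3 (fun w : C(UnitAddCircle, ℝ) => H.field.comp w) :=
    contDiff_postcomp 3 H.field H.contDiff
  have h2 : ∀ w : C(UnitAddCircle, ℝ), ContDiff ℝ 3 (fun z : C(UnitAddCircle, ℝ) => w * z) :=
    fun w => contDiff_const.mul contDiff_id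
  exact (h2 _).comp (((h1.comp (contDiff_const.add (h2 _))).sub contDiff_const).sub (h2 _))

theorem remainder_zero (H : IsCritical f hc x₀) : H.remainder 0 = 0 := by
  simp [remainder]

theorem hasFDerivAt_remainder_zero (H : IsCritical f hc x₀) :
    HasFDerivAt H.remainder (0 : C(UnitAddCircle, ℝ) →L[ℝ] C(UnitAddCircle, ℝ)) 0 := by
  let ψ : C(ℝ, ℝ) := ⟨deriv f, H.continuous_deriv⟩
  have hm : ∀ w : C(UnitAddCircle, ℝ), HasFDerivAt (fun z : C(UnitAddCircle, ℝ) => w * z)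
      (ContinuousLinearMap.mul ℝ C(UnitAddCircle, ℝ) w) 0 :=
    fun w => (ContinuousLinearMap.mul ℝ C(UnitAddCircle, ℝ) w).hasFDerivAt
  have h1 : HasFDerivAt (fun w : C(UnitAddCircle, ℝ) => H.field.comp w)
      (ContinuousLinearMap.mul ℝ C(UnitAddCircle, ℝ) (ψ.comp H.circleSol))
      (H.circleSol + H.circleKer * 0) := by
    have := hasFDerivAt_postcomp H.field ψ (fun s => (H.differentiable s).hasDerivAt)
      (H.circleSol + H.circleKer * 0)
    rwa [mul_zero, add_zero] at this ⊢
  have h2 := ((h1.comp 0 ((hm H.circleKer).const_add H.circleSol)).sub_const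
    (H.field.comp H.circleSol)).sub (hm (H.circleCoeff * H.circleKer))
  have h3 := (ContinuousLinearMap.mul ℝ C(UnitAddCircle, ℝ) H.circleCoker).hasFDerivAt.comp 0 h2
  refine h3.congr_fderiv ?_
  refine ContinuousLinearMap.ext fun z => circle_ext fun t => ?_
  simp [ψ, mul_assoc]

/-- The weight `(v*)²`. -/
noncomputable def sqCoker (H : IsCritical f hc x₀) : C(UnitAddCircle, ℝ) :=
  H.circleCoker * H.circleCoker

/-- The weight `v²`. -/
noncomputable def sqKer (H : IsCritical f hc x₀) : C(UnitAddCircle, ℝ) :=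
  H.circleKer * H.circleKer

theorem circleMean_sqCoker (H : IsCritical f hc x₀) :
    circleMean H.sqCoker = ip (cokerFun f x₀) (cokerFun f x₀) := by
  simp [circleMean_apply, sqCoker, ip]

theorem circleMean_sqKer (H : IsCritical f hc x₀) :
    circleMean H.sqKer = ip (kerFun f x₀) (kerFun f x₀) := by
  simp [circleMean_apply, sqKer, ip]

theorem circleMean_sqCoker_pos (H : IsCritical f hc x₀) : 0 < circleMean H.sqCoker :=
  circleMean_pos fun t => by simpa [sqCoker] using (cokerFun_pos f x₀ t).ne'

theorem circleMean_sqKer_pos (H : IsCritical f hc x₀) : 0 < circleMean H.sqKer :=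
  circleMean_pos fun t => by simpa [sqKer] using (kerFun_pos f x₀ t).ne'

/-- The right-hand side `M z + (h - hc) v* cos(2πt)`. -/
noncomputable def rhs (H : IsCritical f hc x₀) (h : ℝ) (z : C(UnitAddCircle, ℝ)) :
    C(UnitAddCircle, ℝ) :=
  H.remainder z + (h - hc) • (H.circleCoker * circleCos)

theorem rhs_coe (H : IsCritical f hc x₀) (h : ℝ) (z : C(UnitAddCircle, ℝ)) (t : ℝ) :
    H.rhs h z t = H.remainder z t +
      (h - hc) * (cokerFun f x₀ t * Real.cos (2 * Real.pi * t)) := by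
  simp [rhs]

/-- The map `Θ z = z - T (M z)`, with `T` the periodic solution operator. The periodic solutions of
the equation with an added multiple of `v*` are the solutions of
`Θ z = x + (h - hc) T(v* cos)`, where `x` is the coordinate along `v`. -/
noncomputable def reducedMap (H : IsCritical f hc x₀) (z : C(UnitAddCircle, ℝ)) :
    C(UnitAddCircle, ℝ) :=
  z - periodicSolver H.sqCoker H.sqKer (H.remainder z)

/-- The parameters `(x, h)`, embedded in the target of `Θ`. -/
noncomputable def paramEmb (H : IsCritical f hc x₀) (x h : ℝ) : C(UnitAddCircle, ℝ) :=
  x • 1 + (h - hc) • periodicSolver H.sqCoker H.sqKer (H.circleCoker * circleCos)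

theorem reducedMap_eq_iff (H : IsCritical f hc x₀) (z : C(UnitAddCircle, ℝ)) (x h : ℝ) :
    H.reducedMap z = H.paramEmb x h ↔
      (∀ t : ℝ, HasDerivAt (fun t : ℝ => z t)
        (H.rhs h z t - circleMean (H.rhs h z) / circleMean H.sqCoker * H.sqCoker t) t) ∧
        circleMean (H.sqKer * z) = x * circleMean H.sqKer := by
  rw [← eq_smul_one_add_periodicSolver_iff H.circleMean_sqCoker_pos.ne' H.circleMean_sqKer_pos.ne',
    reducedMap, paramEmb, rhs, map_add, map_smul, sub_eq_iff_eq_add]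
  constructor <;> intro h <;> refine h.trans ?_ <;> abel

theorem reducedMap_zero (H : IsCritical f hc x₀) : H.reducedMap 0 = 0 := by
  simp [reducedMap, remainder_zero]

theorem contDiff_reducedMap (H : IsCritical f hc x₀) : ContDiff ℝ 3 H.reducedMap :=
  contDiff_id.sub ((periodicSolver H.sqCoker H.sqKer).contDiff.comp H.contDiff_remainder)

theorem hasFDerivAt_reducedMap_zero (H : IsCritical f hc x₀) :
    HasFDerivAt H.reducedMap
      ((ContinuousLinearEquiv.refl ℝ C(UnitAddCircle, ℝ) :
        C(UnitAddCircle, ℝ) →L[ℝ] C(UnitAddCircle, ℝ))) 0 := by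
  have h := (hasFDerivAt_id (𝕜 := ℝ) (0 : C(UnitAddCircle, ℝ))).sub
    ((periodicSolver H.sqCoker H.sqKer).hasFDerivAt.comp 0 H.hasFDerivAt_remainder_zero)
  refine h.congr_fderiv ?_
  ext
  simp

/-- The function `x₀ + v z` on the line. -/
noncomputable def recon (_H : IsCritical f hc x₀) (z : C(UnitAddCircle, ℝ)) : ℝ → ℝ :=
  fun t => x₀ t + kerFun f x₀ t * z t

/-- The function `v* (u - x₀)` on the circle, which is the `z` in `u = x₀ + v z`. -/
noncomputable def conj (H : IsCritical f hc x₀) (u : ℝ → ℝ) (hu : IsC1Periodic u) :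
    C(UnitAddCircle, ℝ) :=
  circleLift (fun t => cokerFun f x₀ t * (u t - x₀ t))
    (H.continuous_cokerFun.mul (hu.1.continuous.sub H.continuous))
    fun t => by simp only [H.periodic_cokerFun t, hu.2 t, H.periodic t]

theorem conj_coe (H : IsCritical f hc x₀) (u : ℝ → ℝ) (hu : IsC1Periodic u) (t : ℝ) :
    H.conj u hu t = cokerFun f x₀ t * (u t - x₀ t) :=
  circleLift_coe _ _ _ _

theorem recon_conj (H : IsCritical f hc x₀) (u : ℝ → ℝ) (hu : IsC1Periodic u) :
    H.recon (H.conj u hu) = u := by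
  funext t
  have := (kerFun_pos f x₀ t).ne'
  simp only [recon, conj_coe, cokerFun_eq_inv]
  field_simp
  ring

theorem circleMean_sqKer_mul (H : IsCritical f hc x₀) (z : C(UnitAddCircle, ℝ)) :
    circleMean (H.sqKer * z) = ip (kerFun f x₀) (fun t => H.recon z t - x₀ t) := by
  simp [circleMean_apply, sqKer, ip, recon, mul_assoc]

/-- A function that solves the equation up to `β v*` satisfies the reduced equation; integrating
over a period determines `β`. -/
theorem reducedMap_conj (H : IsCritical f hc x₀) {u : ℝ → ℝ} (hu : IsC1Periodic u) {h β x : ℝ}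
    (hΦ : ∀ t, Phi f h u t = β * cokerFun f x₀ t)
    (hx : ip (kerFun f x₀) (fun t => u t - x₀ t) = x * ip (kerFun f x₀) (kerFun f x₀)) :
    H.reducedMap (H.conj u hu) = H.paramEmb x h ∧
      β * circleMean H.sqCoker = -circleMean (H.rhs h (H.conj u hu)) := by
  set z := H.conj u hu with hz
  have hd : ∀ t : ℝ, HasDerivAt (fun t : ℝ => z t) ((H.rhs h z + β • H.sqCoker) t) t := by
    intro t
    have h1 := (H.hasDerivAt_cokerFun t).mul
      ((hasDerivAt_of_Phi_eq hu (hΦ t)).sub (H.hasDerivAt t))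
    refine (h1.congr_deriv ?_).congr_of_eventuallyEq
      (Eventually.of_forall fun s => H.conj_coe u hu s)
    have hv := (kerFun_pos f x₀ t).ne'
    have hr : x₀ t + kerFun f x₀ t * z t = u t := congrFun (H.recon_conj u hu) t
    have hzt : z t = cokerFun f x₀ t * (u t - x₀ t) := H.conj_coe u hu t
    simp only [ContinuousMap.add_apply, ContinuousMap.smul_apply, rhs_coe, remainder_coe, sqCoker,
      ContinuousMap.mul_apply, circleCoker_coe, smul_eq_mul, Pi.sub_apply]
    rw [hr, hzt, cokerFun_eq_inv]
    field_simp
    ring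
  -- A periodic function has a derivative of mean zero.
  have hzero : circleMean (H.rhs h z + β • H.sqCoker) = 0 := by
    rw [circleMean_apply, intervalIntegral.integral_eq_sub_of_hasDerivAt (fun t _ => hd t)
      (intervalIntegrable_coe_circle _ 0 1)]
    have := periodic_coe_circle z 0
    rw [zero_add] at this
    exact sub_eq_zero.2 this
  rw [map_add, map_smul, smul_eq_mul] at hzero
  have hpos := H.circleMean_sqCoker_pos
  refine ⟨(H.reducedMap_eq_iff z x h).2 ⟨fun t => (hd t).congr_deriv ?_, ?_⟩, by linarith⟩
  · have : β = -(circleMean (H.rhs h z) / circleMean H.sqCoker) := by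
      field_simp
      linarith
    rw [ContinuousMap.add_apply, ContinuousMap.smul_apply, smul_eq_mul, this]
    ring
  · rw [circleMean_sqKer_mul, H.recon_conj, hx, circleMean_sqKer]

/-- Conversely, solutions of the reduced equation solve the original one modulo `v*`. -/
theorem of_reducedMap_eq (H : IsCritical f hc x₀) {z : C(UnitAddCircle, ℝ)} {x h : ℝ}
    (hz : H.reducedMap z = H.paramEmb x h) :
    IsC1Periodic (H.recon z) ∧
      (∀ t, Phi f h (H.recon z) t =
        -circleMean (H.rhs h z) / circleMean H.sqCoker * cokerFun f x₀ t) ∧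
      ip (kerFun f x₀) (fun t => H.recon z t - x₀ t) = x * ip (kerFun f x₀) (kerFun f x₀) := by
  obtain ⟨hd, hm⟩ := (H.reducedMap_eq_iff z x h).1 hz
  have hu : ∀ t, HasDerivAt (H.recon z) (f (H.recon z t) + h * Real.cos (2 * Real.pi * t) +
      -circleMean (H.rhs h z) / circleMean H.sqCoker * cokerFun f x₀ t) t := by
    intro t
    refine ((H.hasDerivAt t).add ((H.hasDerivAt_kerFun t).mul (hd t))).congr_deriv ?_
    have hv := (kerFun_pos f x₀ t).ne'
    simp only [rhs_coe, remainder_coe, sqCoker, ContinuousMap.mul_apply, circleCoker_coe, recon]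
    rw [cokerFun_eq_inv]
    field_simp
    ring
  have hper : Function.Periodic (H.recon z) 1 := fun t => by
    have := periodic_coe_circle z t
    simp only at this
    simp only [recon, H.periodic t, H.periodic_kerFun t, this]
  have hcont : Continuous (H.recon z) :=
    continuous_iff_continuousAt.2 fun t => (hu t).continuousAt
  refine ⟨⟨contDiff_one_iff_deriv.2 ⟨fun t => (hu t).differentiableAt, ?_⟩, hper⟩, fun t => ?_, ?_⟩
  · rw [funext fun t => (hu t).deriv]
    have h1 := H.contDiff.continuous.comp hcont
    have h2 := H.continuous_cokerFun
    exact (h1.add (by fun_prop)).add (continuous_const.mul h2)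
  · rw [Phi, (hu t).deriv]
    ring
  · rw [← circleMean_sqKer_mul, hm, circleMean_sqKer]

end IsCritical

/-! ### The Lyapunov–Schmidt family -/

/-- The inverse function theorem at a zero where the derivative is the identity, with all
neighbourhoods made explicit. -/
theorem exists_inverse_of_hasFDerivAt_refl {E : Type*} [NormedAddCommGroup E] [NormedSpace ℝ E]
    [CompleteSpace E] {Θ : E → E} (hΘ : ContDiff ℝ 3 Θ)
    (hd : HasFDerivAt Θ ((ContinuousLinearEquiv.refl ℝ E : E →L[ℝ] E)) 0) (h0 : Θ 0 = 0) :
    ∃ G : E → E, ∃ ρ > 0, ∃ r > 0,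
      (∀ y ∈ Metric.ball (0 : E) ρ, Θ (G y) = y ∧ ContDiffAt ℝ 3 G y) ∧
      (∀ z ∈ Metric.ball (0 : E) r, G (Θ z) = z) ∧
      ∀ y₁ ∈ Metric.ball (0 : E) ρ, ∀ y₂ ∈ Metric.ball (0 : E) ρ,
        ‖G y₁ - G y₂ - (y₁ - y₂)‖ ≤ 1 / 2 * ‖y₁ - y₂‖ := by
  have hcd : ContDiffAt ℝ 3 Θ 0 := hΘ.contDiffAt
  have hstrict := hcd.hasStrictFDerivAt' hd (by norm_num)
  set G : E → E := hcd.localInverse hd (by norm_num)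
  have hG : ContDiffAt ℝ 3 G (Θ 0) := hcd.to_localInverse hd (by norm_num)
  have hGs : HasStrictFDerivAt G
      ((ContinuousLinearEquiv.refl ℝ E).symm : E →L[ℝ] E) (Θ 0) := hstrict.to_localInverse
  have hl : ∀ᶠ z in 𝓝 (0 : E), G (Θ z) = z := hstrict.eventually_left_inverse
  have hr : ∀ᶠ y in 𝓝 (Θ 0), Θ (G y) = y := hstrict.eventually_right_inverse
  obtain ⟨s, hs, happ⟩ := hGs.approximates_deriv_on_nhds (c := 1 / 2) (Or.inr (by norm_num))
  rw [h0] at hG hr hs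
  obtain ⟨ρ, hρ, hball⟩ := Metric.eventually_nhds_iff_ball.1
    ((hr.and (hG.eventually (by norm_cast))).and hs)
  obtain ⟨r, hr0, hrball⟩ := Metric.eventually_nhds_iff_ball.1 hl
  refine ⟨G, ρ, hρ, r, hr0, fun y hy => (hball y hy).1, hrball, fun y₁ h₁ y₂ h₂ => ?_⟩
  simpa using happ y₁ (hball y₁ h₁).2 y₂ (hball y₂ h₂).2

/-- The derivative along the diagonal of a differentiable curve of continuous functions. -/
theorem hasDerivAt_eval_diag {ζ : ℝ → C(UnitAddCircle, ℝ)} {ζ' : C(UnitAddCircle, ℝ)} {d t : ℝ}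
    (hζ : HasDerivAt ζ ζ' t) (hd : HasDerivAt (fun s : ℝ => ζ t s) d t) :
    HasDerivAt (fun s : ℝ => ζ s s) (ζ' t + d) t := by
  rw [hasDerivAt_iff_isLittleO] at hζ hd ⊢
  have h1 : (fun s : ℝ => (ζ s - ζ t - (s - t) • ζ') (s : UnitAddCircle))
      =o[𝓝 t] fun s => s - t :=
    (Asymptotics.IsBigO.of_bound 1 (Eventually.of_forall fun s => by
      rw [one_mul]; exact abs_coe_circle_le _ s)).trans_isLittleO hζ
  have h2 : (fun s : ℝ => (s - t) * (ζ' s - ζ' t)) =o[𝓝 t] fun s => s - t := by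
    have hc : Tendsto (fun s : ℝ => ζ' s - ζ' t) (𝓝 t) (𝓝 0) := by
      have := ((continuous_coe_circle ζ').tendsto t).sub_const (ζ' t)
      rwa [sub_self] at this
    simpa using (Asymptotics.isBigO_refl (fun s : ℝ => s - t) (𝓝 t)).mul_isLittleO
      ((Asymptotics.isLittleO_one_iff ℝ).2 hc)
  refine ((h1.add hd).add h2).congr_left fun s => ?_
  simp only [ContinuousMap.sub_apply, ContinuousMap.smul_apply, smul_eq_mul]
  ring

/-- The Lyapunov–Schmidt family at a critical solution `x₀`: the functions `u x h` solve the
equation up to the multiple `g x h` of `v*`, have coordinate `x` along `v`, and are the only such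
functions near `x₀`. They increase with `x` at a rate between two positive constants. -/
structure ReducedFamily (f : ℝ → ℝ) (hc : ℝ) (x₀ : ℝ → ℝ) where
  /-- The family of solutions of the equation modulo `v*`. -/
  u : ℝ → ℝ → ℝ → ℝ
  /-- The reduced function. -/
  g : ℝ → ℝ → ℝ
  /-- The size of the parameter box. -/
  δ : ℝ
  /-- The size of the neighbourhood of `x₀` in which the family is unique. -/
  r : ℝ
  /-- The least growth rate in `x`. -/
  m : ℝ
  /-- The greatest growth rate in `x`. -/
  M : ℝ
  δ_pos : 0 < δ
  r_pos : 0 < r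
  m_pos : 0 < m
  M_pos : 0 < M
  contDiffAt : ∀ {x h : ℝ}, |x| < δ → |h - hc| < δ →
    ContDiffAt ℝ 3 (fun p : ℝ × ℝ => g p.1 p.2) (x, h)
  isC1Periodic : ∀ {x h : ℝ}, |x| < δ → |h - hc| < δ → IsC1Periodic (u x h)
  Phi_eq : ∀ {x h : ℝ}, |x| < δ → |h - hc| < δ → ∀ t,
    Phi f h (u x h) t = g x h / ip (cokerFun f x₀) (cokerFun f x₀) * cokerFun f x₀ t
  /-- `x` is the coordinate of `u x h - x₀` along `v`. -/
  coord : ∀ {x h : ℝ}, |x| < δ → |h - hc| < δ →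
    ip (kerFun f x₀) (fun t => u x h t - x₀ t) = x * ip (kerFun f x₀) (kerFun f x₀)
  unique : ∀ {x h : ℝ}, |x| < δ → |h - hc| < δ → ∀ {w : ℝ → ℝ} {β : ℝ}, IsC1Periodic w →
    (∀ t, Phi f h w t = β * cokerFun f x₀ t) →
    ip (kerFun f x₀) (fun t => w t - x₀ t) = x * ip (kerFun f x₀) (kerFun f x₀) →
    Near r w x₀ → w = u x h ∧ β * ip (cokerFun f x₀) (cokerFun f x₀) = g x h
  continuous : ∀ {x h : ℝ}, |x| < δ → |h - hc| < δ → ∀ ε > 0,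
    ∀ᶠ p : ℝ × ℝ in 𝓝 (x, h), Near ε (u p.1 p.2) (u x h)
  lower : ∀ {x₁ x₂ h : ℝ}, |x₁| < δ → |x₂| < δ → |h - hc| < δ → x₁ ≤ x₂ → ∀ t,
    m * (x₂ - x₁) ≤ u x₂ h t - u x₁ h t
  upper : ∀ {x₁ x₂ h : ℝ}, |x₁| < δ → |x₂| < δ → |h - hc| < δ → x₁ ≤ x₂ → ∀ t,
    u x₂ h t - u x₁ h t ≤ M * (x₂ - x₁)
  /-- The time derivative when `x = a + κ τ` moves at speed `κ` along the family. -/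
  slide : ∀ {a κ h s : ℝ}, |a + κ * s| < δ → |h - hc| < δ →
    ∃ d ≤ M, HasDerivAt (fun τ => u (a + κ * τ) h τ) (deriv (u (a + κ * s) h) s + κ * d) s

namespace IsCritical

variable {f x₀ : ℝ → ℝ} {hc : ℝ}

theorem exists_reducedFamily (H : IsCritical f hc x₀) : Nonempty (ReducedFamily f hc x₀) := by
  obtain ⟨G, ρ, hρ, r, hr, hG, hGinv, hGapp⟩ := exists_inverse_of_hasFDerivAt_refl
    H.contDiff_reducedMap H.hasFDerivAt_reducedMap_zero H.reducedMap_zero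
  set c := periodicSolver H.sqCoker H.sqKer (H.circleCoker * circleCos) with hcdef
  have hpar : ∀ x h, H.paramEmb x h = x • 1 + (h - hc) • c := fun _ _ => rfl
  -- Parameters in this box are mapped into the ball on which the inverse `G` is defined.
  set δ := ρ / (2 * (1 + ‖c‖)) with hδdef
  have hδ : 0 < δ := by positivity
  have hbox : ∀ {x h : ℝ}, |x| < δ → |h - hc| < δ → H.paramEmb x h ∈ Metric.ball 0 ρ := by
    intro x h hx hh
    rw [mem_ball_zero_iff, hpar]
    have h1 : δ * (1 + ‖c‖) = ρ / 2 := by rw [hδdef]; field_simp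
    calc ‖x • (1 : C(UnitAddCircle, ℝ)) + (h - hc) • c‖
        ≤ |x| * 1 + |h - hc| * ‖c‖ := by
          refine (norm_add_le _ _).trans ?_
          rw [norm_smul, norm_smul, norm_one, Real.norm_eq_abs, Real.norm_eq_abs]
      _ ≤ δ * 1 + δ * ‖c‖ := by gcongr
      _ < ρ := by linarith
  have hparC : ContDiff ℝ 3 (fun p : ℝ × ℝ => H.paramEmb p.1 p.2) := by
    simp only [hpar]
    fun_prop
  have hzC : ∀ {x h : ℝ}, |x| < δ → |h - hc| < δ →
      ContDiffAt ℝ 3 (fun p : ℝ × ℝ => G (H.paramEmb p.1 p.2)) (x, h) := fun {x h} hx hh =>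
    ContDiffAt.comp (x, h) (hG _ (hbox hx hh)).2 hparC.contDiffAt
  set V := ‖H.circleKer‖
  set Vs := ‖H.circleCoker‖
  have hV : ∀ t, kerFun f x₀ t ≤ V := H.kerFun_le
  have hVs : ∀ t, cokerFun f x₀ t ≤ Vs := H.cokerFun_le
  have hVpos : 0 < V := (kerFun_pos f x₀ 0).trans_le (hV 0)
  have hVspos : 0 < Vs := (cokerFun_pos f x₀ 0).trans_le (hVs 0)
  have hVlow : ∀ t, Vs⁻¹ ≤ kerFun f x₀ t := H.le_kerFun
  have happ : ∀ {x₁ x₂ h : ℝ}, |x₁| < δ → |x₂| < δ → |h - hc| < δ → x₁ ≤ x₂ → ∀ t : ℝ,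
      |G (H.paramEmb x₂ h) t - G (H.paramEmb x₁ h) t - (x₂ - x₁)| ≤ 1 / 2 * (x₂ - x₁) := by
    intro x₁ x₂ h h₁ h₂ hh hle t
    have h3 := hGapp _ (hbox h₂ hh) _ (hbox h₁ hh)
    have h4 : H.paramEmb x₂ h - H.paramEmb x₁ h = (x₂ - x₁) • 1 := by
      rw [hpar, hpar, add_sub_add_right_eq_sub, sub_smul]
    rw [h4, norm_smul, norm_one, mul_one, Real.norm_of_nonneg (sub_nonneg.2 hle)] at h3
    have h5 := (abs_coe_circle_le _ t).trans h3
    simpa using h5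
  refine ⟨{ u := fun x h => H.recon (G (H.paramEmb x h))
            g := fun x h => -circleMean (H.rhs h (G (H.paramEmb x h)))
            δ := δ
            r := r / Vs
            m := Vs⁻¹ * (1 / 2)
            M := V * (3 / 2)
            δ_pos := hδ
            r_pos := by positivity
            m_pos := by positivity
            M_pos := by positivity
            contDiffAt := ?_
            isC1Periodic := ?_
            Phi_eq := ?_
            coord := ?_
            unique := ?_
            continuous := ?_
            lower := ?_
            upper := ?_
            slide := ?_ }⟩
  · intro x h hx hh
    have h1 := H.contDiff_remainder.contDiffAt.comp (x, h) (hzC hx hh)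
    have h2 : ContDiffAt ℝ 3
        (fun p : ℝ × ℝ => (p.2 - hc) • (H.circleCoker * circleCos)) (x, h) := by
      fun_prop
    exact (circleMean.contDiff.contDiffAt.comp (x, h) (h1.add h2)).neg
  · intro x h hx hh
    exact (H.of_reducedMap_eq (hG _ (hbox hx hh)).1).1
  · intro x h hx hh
    rw [← H.circleMean_sqCoker]
    exact (H.of_reducedMap_eq (hG _ (hbox hx hh)).1).2.1
  · intro x h hx hh
    exact (H.of_reducedMap_eq (hG _ (hbox hx hh)).1).2.2
  · intro x h hx hh w β hw hΦ hcoord hnear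
    obtain ⟨h1, h2⟩ := H.reducedMap_conj hw hΦ hcoord
    have hball : H.conj w hw ∈ Metric.ball 0 r := by
      rw [mem_ball_zero_iff, ContinuousMap.norm_lt_iff _ hr]
      intro c
      obtain ⟨t, -, rfl⟩ := AddCircle.eq_coe_Ico c
      rw [H.conj_coe, norm_mul, Real.norm_of_nonneg (cokerFun_pos f x₀ t).le]
      calc cokerFun f x₀ t * ‖w t - x₀ t‖ ≤ Vs * ‖w t - x₀ t‖ := by
            gcongr; exact hVs t
        _ < Vs * (r / Vs) := by gcongr; exact hnear t
        _ = r := by field_simp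
    have h3 := hGinv _ hball
    rw [h1] at h3
    rw [← H.circleMean_sqCoker, h2, h3, H.recon_conj]
    exact ⟨rfl, rfl⟩
  · intro x h hx hh ε hε
    have h1 := Metric.continuousAt_iff'.1 (hzC hx hh).continuousAt (ε / V) (by positivity)
    filter_upwards [h1] with p hp t
    rw [dist_eq_norm] at hp
    have h2 := (abs_coe_circle_le _ t).trans_lt hp
    have h3 : H.recon (G (H.paramEmb p.1 p.2)) t - H.recon (G (H.paramEmb x h)) t =
        kerFun f x₀ t * (G (H.paramEmb p.1 p.2) - G (H.paramEmb x h)) t := by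
      simp only [recon, ContinuousMap.sub_apply]; ring
    rw [h3, abs_mul, abs_of_pos (kerFun_pos f x₀ t)]
    calc _ ≤ V * |(G (H.paramEmb p.1 p.2) - G (H.paramEmb x h)) t| := by
            gcongr; exact hV t
      _ < V * (ε / V) := by gcongr
      _ = ε := by field_simp
  · intro x₁ x₂ h h₁ h₂ hh hle t
    have h3 := (abs_le.1 (happ h₁ h₂ hh hle t)).1
    have h4 : 1 / 2 * (x₂ - x₁) ≤ G (H.paramEmb x₂ h) t - G (H.paramEmb x₁ h) t := by linarith
    calc Vs⁻¹ * (1 / 2) * (x₂ - x₁) = Vs⁻¹ * (1 / 2 * (x₂ - x₁)) := by ring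
      _ ≤ kerFun f x₀ t * (G (H.paramEmb x₂ h) t - G (H.paramEmb x₁ h) t) :=
          mul_le_mul (hVlow t) h4 (by linarith) (kerFun_pos f x₀ t).le
      _ = _ := by simp only [recon]; ring
  · intro x₁ x₂ h h₁ h₂ hh hle t
    have h3 := (abs_le.1 (happ h₁ h₂ hh hle t)).2
    have h4 : G (H.paramEmb x₂ h) t - G (H.paramEmb x₁ h) t ≤ 3 / 2 * (x₂ - x₁) := by linarith
    calc _ = kerFun f x₀ t * (G (H.paramEmb x₂ h) t - G (H.paramEmb x₁ h) t) := by
            simp only [recon]; ring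
      _ ≤ kerFun f x₀ t * (3 / 2 * (x₂ - x₁)) := by
            have := (kerFun_pos f x₀ t).le
            gcongr
      _ ≤ V * (3 / 2 * (x₂ - x₁)) := by
            have : 0 ≤ 3 / 2 * (x₂ - x₁) := by linarith
            gcongr; exact hV t
      _ = _ := by ring
  · intro a κ h s hs hh
    obtain ⟨hinv, hGd⟩ := hG _ (hbox hs hh)
    set y := H.paramEmb (a + κ * s) h with hy
    have hGd' := (hGd.differentiableAt (by norm_num)).hasFDerivAt
    -- On the ball, the inverse is Lipschitz with constant `3 / 2`.
    have hlip : LipschitzOnWith (3 / 2) G (Metric.ball 0 ρ) := by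
      refine LipschitzOnWith.of_dist_le_mul fun y₁ h₁ y₂ h₂ => ?_
      rw [dist_eq_norm, dist_eq_norm]
      have h3 := hGapp y₁ h₁ y₂ h₂
      have h4 := norm_add_le (G y₁ - G y₂ - (y₁ - y₂)) (y₁ - y₂)
      rw [sub_add_cancel] at h4
      have h5 : ((3 / 2 : NNReal) : ℝ) = 3 / 2 := by norm_num
      rw [h5]
      linarith
    have hnorm := hGd'.le_of_lipschitzOn (Metric.isOpen_ball.mem_nhds (hbox hs hh)) hlip
    set D := fderiv ℝ G y
    have hcurve : HasDerivAt (fun τ => G (H.paramEmb (a + κ * τ) h)) (D (κ • 1)) s := by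
      refine HasFDerivAt.comp_hasDerivAt s hGd' ?_
      have h1 : HasDerivAt (fun τ : ℝ => a + κ * τ) κ s := by
        simpa using ((hasDerivAt_id s).const_mul κ).const_add a
      exact (h1.smul_const (1 : C(UnitAddCircle, ℝ))).add_const ((h - hc) • c)
    obtain ⟨hC1, -, -⟩ := H.of_reducedMap_eq hinv
    have hzd := ((H.reducedMap_eq_iff _ _ _).1 hinv).1 s
    have hdiag := hasDerivAt_eval_diag hcurve hzd
    refine ⟨kerFun f x₀ s * D 1 s, ?_, ?_⟩
    · have h1 : D 1 s ≤ 3 / 2 := by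
        refine (le_abs_self _).trans ((abs_coe_circle_le _ s).trans ?_)
        refine (D.le_opNorm 1).trans ?_
        rw [norm_one, mul_one]
        simpa using hnorm
      have h2 := (kerFun_pos f x₀ s).le
      calc kerFun f x₀ s * D 1 s ≤ kerFun f x₀ s * (3 / 2) := by gcongr
        _ ≤ V * (3 / 2) := by gcongr; exact hV s
    · have hrec := (H.hasDerivAt s).add ((H.hasDerivAt_kerFun s).mul hzd)
      have hrec' : deriv (H.recon (G y)) s = _ := hrec.deriv
      rw [hrec']
      refine ((H.hasDerivAt s).add ((H.hasDerivAt_kerFun s).mul hdiag)).congr_deriv ?_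
      simp only [map_smul, ContinuousMap.smul_apply, smul_eq_mul, ← hy]
      ring

end IsCritical

variable {f x₀ : ℝ → ℝ} {hc : ℝ}

/-! ### Reduced functions -/

/-- A periodic solution solves the equation modulo `v*`, with multiple `β = 0`. -/
theorem IsPeriodicSolution.Phi_eq {u : ℝ → ℝ} {h : ℝ} (hu : IsPeriodicSolution f h u)
    (x₀ : ℝ → ℝ) (t : ℝ) : Phi f h u t = 0 * cokerFun f x₀ t := by
  rw [hu.2, zero_mul]

theorem ip_const_mul (y z : ℝ → ℝ) (c : ℝ) : ip y (fun t => c * z t) = c * ip y z := by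
  rw [ip, ip, ← intervalIntegral.integral_const_mul]
  congr 1
  funext t
  ring

namespace IsCritical

theorem contDiff_kerFun (H : IsCritical f hc x₀) : ContDiff ℝ 1 (kerFun f x₀) := by
  refine contDiff_one_iff_deriv.2 ⟨fun t => (H.hasDerivAt_kerFun t).differentiableAt, ?_⟩
  rw [funext fun t => (H.hasDerivAt_kerFun t).deriv]
  exact H.continuous_coeff.mul H.continuous_kerFun

theorem ip_coker_pos (H : IsCritical f hc x₀) : 0 < ip (cokerFun f x₀) (cokerFun f x₀) :=
  H.circleMean_sqCoker ▸ H.circleMean_sqCoker_pos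

theorem ip_ker_pos (H : IsCritical f hc x₀) : 0 < ip (kerFun f x₀) (kerFun f x₀) :=
  H.circleMean_sqKer ▸ H.circleMean_sqKer_pos

end IsCritical

namespace ReducedFamily

theorem eventually_box (L : ReducedFamily f hc x₀) :
    ∀ᶠ p : ℝ × ℝ in 𝓝 (0, hc), |p.1| < L.δ ∧ |p.2 - hc| < L.δ := by
  have h1 : Continuous (fun p : ℝ × ℝ => |p.1|) := by fun_prop
  have h2 : Continuous (fun p : ℝ × ℝ => |p.2 - hc|) := by fun_prop
  refine ((h1.tendsto _).eventually_lt_const ?_).and ((h2.tendsto _).eventually_lt_const ?_) <;>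
  simp [L.δ_pos]

theorem eventually_box_snd (L : ReducedFamily f hc x₀) : ∀ᶠ h in 𝓝 hc, |h - hc| < L.δ := by
  have h2 : Continuous (fun h : ℝ => |h - hc|) := by fun_prop
  exact (h2.tendsto _).eventually_lt_const (by simp [L.δ_pos])

theorem eq_at_base (L : ReducedFamily f hc x₀) (H : IsCritical f hc x₀) :
    L.u 0 hc = x₀ ∧ L.g 0 hc = 0 := by
  have h0 : |(0 : ℝ)| < L.δ := by simpa using L.δ_pos
  have h1 : |hc - hc| < L.δ := by simpa using L.δ_pos
  obtain ⟨h2, h3⟩ := L.unique h0 h1 H.sol.1 (H.sol.Phi_eq x₀) (by simp [ip])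
    (fun t => by simpa using L.r_pos)
  exact ⟨h2.symm, by simpa using h3.symm⟩

theorem eventually_near (L : ReducedFamily f hc x₀) (H : IsCritical f hc x₀) {ε : ℝ}
    (hε : 0 < ε) : ∀ᶠ p : ℝ × ℝ in 𝓝 (0, hc), Near ε (L.u p.1 p.2) x₀ := by
  have := L.continuous (x := 0) (h := hc) (by simpa using L.δ_pos) (by simpa using L.δ_pos) ε hε
  rwa [(L.eq_at_base H).1] at this

theorem hasDerivAt_u (L : ReducedFamily f hc x₀) {x h : ℝ} (hx : |x| < L.δ)
    (hh : |h - hc| < L.δ) (t : ℝ) : HasDerivAt (L.u x h) (f (L.u x h t) +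
      h * Real.cos (2 * Real.pi * t) +
      L.g x h / ip (cokerFun f x₀) (cokerFun f x₀) * cokerFun f x₀ t) t :=
  hasDerivAt_of_Phi_eq (L.isC1Periodic hx hh) (L.Phi_eq hx hh t)

/-- The derivatives `u'(x, h)` converge uniformly to `x₀'`. -/
theorem eventually_deriv_near (L : ReducedFamily f hc x₀) (H : IsCritical f hc x₀) {ε : ℝ}
    (hε : 0 < ε) :
    ∀ᶠ p : ℝ × ℝ in 𝓝 (0, hc), ∀ t, |deriv (L.u p.1 p.2) t - deriv x₀ t| < ε := by
  set B := ‖H.circleSol‖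
  have hB : ∀ t, |x₀ t| ≤ B := fun t => by simpa using abs_coe_circle_le H.circleSol t
  obtain ⟨K, hK⟩ := exists_lipschitzOnWith_Icc (H.contDiff.of_le (by norm_num)) (B + 1)
  have hip := H.ip_coker_pos
  set S := ‖H.circleCoker‖
  have hg : ContinuousAt (fun p : ℝ × ℝ => L.g p.1 p.2) (0, hc) :=
    (L.contDiffAt (by simpa using L.δ_pos) (by simpa using L.δ_pos)).continuousAt
  have hη : 0 < min 1 (ε / (2 * (K + 1))) := by positivity
  have hsmall : ∀ᶠ p : ℝ × ℝ in 𝓝 (0, hc), |p.2 - hc| +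
      |L.g p.1 p.2| / ip (cokerFun f x₀) (cokerFun f x₀) * S < ε / 2 := by
    have hcont : ContinuousAt (fun p : ℝ × ℝ => |p.2 - hc| +
      |L.g p.1 p.2| / ip (cokerFun f x₀) (cokerFun f x₀) * S) (0, hc) :=
      (by fun_prop : ContinuousAt (fun p : ℝ × ℝ => |p.2 - hc|) (0, hc)).add
        ((hg.abs.div_const _).mul_const _)
    refine hcont.tendsto.eventually_lt_const ?_
    simp [(L.eq_at_base H).2, hε]
  filter_upwards [L.eventually_near H hη, L.eventually_box, hsmall] with p hp hbox hps t
  rw [(L.hasDerivAt_u hbox.1 hbox.2 t).deriv, (H.hasDerivAt t).deriv]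
  have hpt := hp t
  have hx := hB t
  have hux : |L.u p.1 p.2 t| ≤ B + 1 := by
    have := abs_add_le (L.u p.1 p.2 t - x₀ t) (x₀ t)
    rw [sub_add_cancel] at this
    have := min_le_left 1 (ε / (2 * ((K : ℝ) + 1)))
    linarith
  have hLip := hK.dist_le_mul _ (abs_le.1 hux) _ (abs_le.1 (hx.trans (by linarith)))
  rw [Real.dist_eq, Real.dist_eq] at hLip
  have h1 : |f (L.u p.1 p.2 t) - f (x₀ t)| ≤ ε / 2 := by
    refine hLip.trans ?_
    calc (K : ℝ) * |L.u p.1 p.2 t - x₀ t| ≤ (K + 1) * (ε / (2 * (K + 1))) := by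
          gcongr
          · linarith
          · exact (hpt.trans_le (min_le_right _ _)).le
      _ = ε / 2 := by field_simp
  have h2 : |(p.2 - hc) * Real.cos (2 * Real.pi * t)| ≤ |p.2 - hc| := by
    rw [abs_mul]
    exact mul_le_of_le_one_right (abs_nonneg _) (Real.abs_cos_le_one _)
  have h3 : |L.g p.1 p.2 / ip (cokerFun f x₀) (cokerFun f x₀) * cokerFun f x₀ t| ≤
      |L.g p.1 p.2| / ip (cokerFun f x₀) (cokerFun f x₀) * S := by
    rw [abs_mul, abs_div, abs_of_pos hip, abs_of_pos (cokerFun_pos f x₀ t)]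
    gcongr
    exact H.cokerFun_le t
  have h4 := abs_add_three (f (L.u p.1 p.2 t) - f (x₀ t))
    ((p.2 - hc) * Real.cos (2 * Real.pi * t))
    (L.g p.1 p.2 / ip (cokerFun f x₀) (cokerFun f x₀) * cokerFun f x₀ t)
  refine lt_of_eq_of_lt ?_ (h4.trans_lt (by linarith))
  congr 1
  ring

theorem isReducedFunction (L : ReducedFamily f hc x₀) (H : IsCritical f hc x₀) :
    IsReducedFunction f hc x₀ L.g := by
  have hip := H.ip_coker_pos
  have hans : ∀ x h, ansatz f x₀ x (fun t => L.u x h t - x₀ t - x * kerFun f x₀ t) = L.u x h := by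
    intro x h
    funext t
    simp only [ansatz]
    ring
  have hvd : ∀ x t, HasDerivAt (fun t => x * kerFun f x₀ t)
      (x * (deriv f (x₀ t) * kerFun f x₀ t)) t := fun x t => (H.hasDerivAt_kerFun t).const_mul x
  refine ⟨fun x h t => L.u x h t - x₀ t - x * kerFun f x₀ t, ?_, ?_⟩
  · filter_upwards [L.eventually_box] with p hp
    have hu := L.isC1Periodic hp.1 hp.2
    have hPhi : Phi f p.2 (L.u p.1 p.2) = fun t =>
        L.g p.1 p.2 / ip (cokerFun f x₀) (cokerFun f x₀) * cokerFun f x₀ t :=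
      funext (L.Phi_eq hp.1 hp.2)
    have hval : ip (cokerFun f x₀) (Phi f p.2 (L.u p.1 p.2)) = L.g p.1 p.2 := by
      rw [hPhi, ip_const_mul, div_mul_cancel₀ _ hip.ne']
    refine ⟨⟨(hu.1.sub H.sol.1.1).sub (contDiff_const.mul H.contDiff_kerFun),
      fun t => ?_⟩, ?_, fun t => ?_, ?_⟩
    · simp only [hu.2 t, H.periodic t, H.periodic_kerFun t]
    · have h1 := L.coord hp.1 hp.2
      have hi1 : IntervalIntegrable (fun t => kerFun f x₀ t * (L.u p.1 p.2 t - x₀ t))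
          MeasureTheory.volume 0 1 :=
        (H.continuous_kerFun.mul (hu.1.continuous.sub H.continuous)).intervalIntegrable _ _
      have hi2 : IntervalIntegrable (fun t => p.1 * (kerFun f x₀ t * kerFun f x₀ t))
          MeasureTheory.volume 0 1 :=
        (continuous_const.mul (H.continuous_kerFun.mul H.continuous_kerFun)).intervalIntegrable _ _
      have h2 := intervalIntegral.integral_sub hi1 hi2
      rw [intervalIntegral.integral_const_mul] at h2
      simp only [ip] at h1 ⊢
      rw [h1, sub_self] at h2
      rw [← h2]
      congr 1
      funext t
      ring
    · rw [hans, rangeProj, hval, hPhi, sub_self]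
    · rw [hans, hval]
  · intro ε hε
    obtain ⟨A, hA⟩ : ∃ A, ∀ t, |deriv f (x₀ t) * kerFun f x₀ t| ≤ A :=
      ⟨‖H.circleCoeff * H.circleKer‖, fun t => by
        simpa using abs_coe_circle_le (H.circleCoeff * H.circleKer) t⟩
    have hx1 : ∀ᶠ p : ℝ × ℝ in 𝓝 (0, hc), |p.1| * (‖H.circleKer‖ + A) < ε / 2 := by
      have hcont : Continuous (fun p : ℝ × ℝ => |p.1| * (‖H.circleKer‖ + A)) := by fun_prop
      refine (hcont.tendsto _).eventually_lt_const ?_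
      simp [hε]
    have hA0 : 0 ≤ A := (abs_nonneg _).trans (hA 0)
    filter_upwards [L.eventually_box, L.eventually_near H (half_pos hε),
      L.eventually_deriv_near H (half_pos hε), hx1] with p hp hnear hdnear hx t
    have h1 : |p.1 * kerFun f x₀ t| ≤ |p.1| * (‖H.circleKer‖ + A) := by
      rw [abs_mul, abs_of_pos (kerFun_pos f x₀ t)]
      have := H.kerFun_le t
      gcongr
      linarith
    have h2 : |p.1 * (deriv f (x₀ t) * kerFun f x₀ t)| ≤ |p.1| * (‖H.circleKer‖ + A) := by
      rw [abs_mul]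
      have := hA t
      have := norm_nonneg H.circleKer
      gcongr
      linarith
    refine ⟨?_, ?_⟩
    · have h3 := abs_sub (L.u p.1 p.2 t - x₀ t) (p.1 * kerFun f x₀ t)
      have h4 := hnear t
      linarith
    · have hd := ((L.hasDerivAt_u hp.1 hp.2 t).sub (H.hasDerivAt t)).sub (hvd p.1 t)
      have h5 := hdnear t
      rw [(L.hasDerivAt_u hp.1 hp.2 t).deriv, (H.hasDerivAt t).deriv] at h5
      have h6 := abs_sub (f (L.u p.1 p.2 t) + p.2 * Real.cos (2 * Real.pi * t) +
        L.g p.1 p.2 / ip (cokerFun f x₀) (cokerFun f x₀) * cokerFun f x₀ t -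
        (f (x₀ t) + hc * Real.cos (2 * Real.pi * t))) (p.1 * (deriv f (x₀ t) * kerFun f x₀ t))
      have hd' : deriv (fun t => L.u p.1 p.2 t - x₀ t - p.1 * kerFun f x₀ t) t = _ := hd.deriv
      rw [hd']
      linarith

/-- By local uniqueness, every reduced function is, near `(0, hc)`, the one of the family. -/
theorem eventuallyEq_of_isReducedFunction (L : ReducedFamily f hc x₀) (H : IsCritical f hc x₀)
    {g : ℝ → ℝ → ℝ} (hg : IsReducedFunction f hc x₀ g) :
    ∀ᶠ p : ℝ × ℝ in 𝓝 (0, hc), g p.1 p.2 = L.g p.1 p.2 := by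
  obtain ⟨W, hW, hWsmall⟩ := hg
  have hip := H.ip_coker_pos
  have hx1 : ∀ᶠ p : ℝ × ℝ in 𝓝 (0, hc), |p.1| * ‖H.circleKer‖ < L.r / 2 := by
    have hcont : Continuous (fun p : ℝ × ℝ => |p.1| * ‖H.circleKer‖) := by fun_prop
    refine (hcont.tendsto _).eventually_lt_const ?_
    simp [L.r_pos]
  filter_upwards [hW, hWsmall _ (half_pos L.r_pos), L.eventually_box, hx1] with p hp hps hbox hx
  obtain ⟨hW1, hW2, hW3, hW4⟩ := hp
  set w := ansatz f x₀ p.1 (W p.1 p.2) with hw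
  have hwC : IsC1Periodic w := by
    refine ⟨(H.sol.1.1.add (contDiff_const.mul H.contDiff_kerFun)).add hW1.1, fun t => ?_⟩
    simp only [hw, ansatz, hW1.2 t, H.periodic t, H.periodic_kerFun t]
  have hcoord : ip (kerFun f x₀) (fun t => w t - x₀ t) =
      p.1 * ip (kerFun f x₀) (kerFun f x₀) := by
    have hi1 : IntervalIntegrable (fun t => p.1 * (kerFun f x₀ t * kerFun f x₀ t))
        MeasureTheory.volume 0 1 :=
      (continuous_const.mul (H.continuous_kerFun.mul H.continuous_kerFun)).intervalIntegrable _ _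
    have hi2 : IntervalIntegrable (fun t => kerFun f x₀ t * W p.1 p.2 t)
        MeasureTheory.volume 0 1 :=
      (H.continuous_kerFun.mul hW1.1.continuous).intervalIntegrable _ _
    have h2 := intervalIntegral.integral_add hi1 hi2
    rw [intervalIntegral.integral_const_mul] at h2
    simp only [ip] at hW2 ⊢
    rw [hW2, add_zero] at h2
    rw [← h2]
    congr 1
    funext t
    simp only [hw, ansatz]
    ring
  have hnear : Near L.r w x₀ := by
    intro t
    have h1 : |p.1 * kerFun f x₀ t| ≤ |p.1| * ‖H.circleKer‖ := by
      rw [abs_mul, abs_of_pos (kerFun_pos f x₀ t)]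
      exact mul_le_mul_of_nonneg_left (H.kerFun_le t) (abs_nonneg _)
    have h2 := abs_add_le (p.1 * kerFun f x₀ t) (W p.1 p.2 t)
    have h3 := (hps t).1
    have h4 : w t - x₀ t = p.1 * kerFun f x₀ t + W p.1 p.2 t := by
      simp only [hw, ansatz]; ring
    rw [h4]
    linarith
  have h5 := (L.unique hbox.1 hbox.2 hwC (fun t => sub_eq_zero.1 (hW3 t)) hcoord hnear).2
  rw [div_mul_cancel₀ _ hip.ne'] at h5
  rw [hW4, h5]

end ReducedFamily

/-! ### The symmetry -/

theorem deriv_even_of_odd (hodd : ∀ x, f (-x) = -f x) (x : ℝ) : deriv f (-x) = deriv f x := by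
  have h1 : deriv (fun y => f (-y)) x = -deriv f (-x) := deriv_comp_neg f x
  rw [funext hodd, deriv.fun_neg] at h1
  linarith

theorem IsC1Periodic.reflect {w : ℝ → ℝ} (hw : IsC1Periodic w) : IsC1Periodic (reflect w) := by
  refine ⟨(hw.1.comp (contDiff_id.add contDiff_const)).neg, fun t => ?_⟩
  have := hw.2 (t + 1 / 2)
  simp only [PeriodicBistable.reflect]
  rw [← this]
  ring_nf

theorem Phi_reflect (hodd : ∀ x, f (-x) = -f x) (h : ℝ) (w : ℝ → ℝ) (t : ℝ) :
    Phi f h (reflect w) t = -Phi f h w (t + 1 / 2) := by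
  have h1 : deriv (reflect w) t = -deriv w (t + 1 / 2) := by
    unfold reflect
    rw [deriv.fun_neg, deriv_comp_add_const]
  have h2 : Real.cos (2 * Real.pi * (t + 1 / 2)) = -Real.cos (2 * Real.pi * t) := by
    rw [← Real.cos_add_pi]
    congr 1
    ring
  rw [Phi, Phi, h1, h2]
  simp only [reflect, hodd]
  ring

theorem Near.reflect {r : ℝ} {w : ℝ → ℝ} (hw : Near r w x₀) (hsym : reflect x₀ = x₀) :
    Near r (reflect w) x₀ := by
  intro t
  have h1 := hw (t + 1 / 2)
  rw [← congrFun hsym t]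
  simp only [PeriodicBistable.reflect]
  rw [← abs_neg]
  convert h1 using 2
  ring

namespace IsCritical

/-- The coefficient `f' ∘ x₀` has period `1 / 2` and mean zero, so its exponential primitive has
period `1 / 2`. -/
theorem kerFun_add_half (H : IsCritical f hc x₀) (hodd : ∀ x, f (-x) = -f x)
    (hsym : reflect x₀ = x₀) (t : ℝ) : kerFun f x₀ (t + 1 / 2) = kerFun f x₀ t := by
  have hper : Function.Periodic (fun s => deriv f (x₀ s)) (1 / 2) := fun s => by
    have h1 : x₀ s = -x₀ (s + 1 / 2) := (congrFun hsym s).symm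
    simp only
    rw [h1, deriv_even_of_odd hodd]
  have hint := fun a b => H.continuous_coeff.intervalIntegrable (μ := MeasureTheory.volume) a b
  have h0 : ∫ s in (0 : ℝ)..(1 / 2), deriv f (x₀ s) = 0 := by
    have h1 := H.int_eq_zero
    have h2 := hper.intervalIntegral_add_eq (1 / 2) 0
    rw [← intervalIntegral.integral_add_adjacent_intervals (hint 0 (1 / 2)) (hint (1 / 2) 1)] at h1
    norm_num at h1 h2 ⊢
    linarith
  unfold kerFun
  rw [← intervalIntegral.integral_add_adjacent_intervals (hint 0 t) (hint t (t + 1 / 2)),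
    hper.intervalIntegral_add_eq t 0, zero_add, h0, add_zero]

theorem ip_ker_reflect (H : IsCritical f hc x₀) (hodd : ∀ x, f (-x) = -f x)
    (hsym : reflect x₀ = x₀) {w : ℝ → ℝ} (hw : Function.Periodic w 1) :
    ip (kerFun f x₀) (fun t => reflect w t - x₀ t) =
      -ip (kerFun f x₀) (fun t => w t - x₀ t) := by
  have hper : Function.Periodic (fun t => kerFun f x₀ t * (w t - x₀ t)) 1 := fun t => by
    simp only [H.periodic_kerFun t, hw t, H.periodic t]
  have h1 := hper.intervalIntegral_add_eq (1 / 2) 0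
  rw [zero_add, add_comm (1 / 2 : ℝ) 1, ← zero_add (1 / 2 : ℝ), ← add_assoc, add_zero,
    ← intervalIntegral.integral_comp_add_right (fun t => kerFun f x₀ t * (w t - x₀ t))] at h1
  rw [ip, ip, ← h1, ← intervalIntegral.integral_neg]
  congr 1
  funext t
  have h2 : x₀ t = -x₀ (t + 1 / 2) := (congrFun hsym t).symm
  rw [H.kerFun_add_half hodd hsym, h2]
  simp only [reflect]
  ring

end IsCritical

namespace ReducedFamily

/-- The reflection `R` maps solutions modulo `v*` to solutions modulo `v*` and changes the signs of
both `x` and the multiple of `v*`. -/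
theorem eventually_odd (L : ReducedFamily f hc x₀) (H : IsCritical f hc x₀)
    (hodd : ∀ x, f (-x) = -f x) (hsym : reflect x₀ = x₀) :
    ∀ᶠ p : ℝ × ℝ in 𝓝 (0, hc),
      L.u (-p.1) p.2 = reflect (L.u p.1 p.2) ∧ L.g (-p.1) p.2 = -L.g p.1 p.2 := by
  have hip := H.ip_coker_pos
  filter_upwards [L.eventually_box, L.eventually_near H L.r_pos] with p hp hnear
  have hu := L.isC1Periodic hp.1 hp.2
  obtain ⟨h1, h2⟩ := L.unique (x := -p.1) (by rw [abs_neg]; exact hp.1) hp.2 hu.reflect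
    (β := -(L.g p.1 p.2 / ip (cokerFun f x₀) (cokerFun f x₀)))
    (fun t => by
      rw [Phi_reflect hodd, L.Phi_eq hp.1 hp.2, cokerFun_eq_inv, cokerFun_eq_inv,
        H.kerFun_add_half hodd hsym]
      ring)
    (by rw [H.ip_ker_reflect hodd hsym hu.2, L.coord hp.1 hp.2]; ring)
    (hnear.reflect hsym)
  refine ⟨h1.symm, ?_⟩
  rw [← h2]
  field_simp

/-- Symmetric solutions near `x₀` have coordinate `0` along `v`. -/
theorem eq_of_symmetric (L : ReducedFamily f hc x₀) (H : IsCritical f hc x₀)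
    (hodd : ∀ x, f (-x) = -f x) (hsym : reflect x₀ = x₀) {h : ℝ} (hh : |h - hc| < L.δ)
    {w : ℝ → ℝ} (hw : IsPeriodicSolution f h w) (hws : reflect w = w) (hnear : Near L.r w x₀) :
    w = L.u 0 h ∧ L.g 0 h = 0 := by
  have h1 := H.ip_ker_reflect hodd hsym hw.1.2
  rw [hws] at h1
  obtain ⟨h2, h3⟩ := L.unique (x := 0) (by simpa using L.δ_pos) hh hw.1 (hw.Phi_eq x₀)
    (by linarith) hnear
  exact ⟨h2, by rw [← h3, zero_mul]⟩

/-! ### Stability along the family -/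

theorem isPeriodicSolution_iff (L : ReducedFamily f hc x₀) (H : IsCritical f hc x₀) {x h : ℝ}
    (hx : |x| < L.δ) (hh : |h - hc| < L.δ) : IsPeriodicSolution f h (L.u x h) ↔ L.g x h = 0 := by
  have hip := H.ip_coker_pos.ne'
  constructor
  · intro hs
    have h1 := hs.2 0
    rw [L.Phi_eq hx hh] at h1
    have h2 := (cokerFun_pos f x₀ 0).ne'
    simpa [hip, h2] using h1
  · intro hg
    exact ⟨L.isC1Periodic hx hh, fun t => by rw [L.Phi_eq hx hh, hg]; simp⟩

/-- If `g(·, h) ≤ 0` just below `x` and `g(·, h) ≥ 0` just above, then the neighbouring members of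
the family are sub- and supersolutions that enclose `u x h`. -/
theorem isStable (L : ReducedFamily f hc x₀) (H : IsCritical f hc x₀) {x h η : ℝ}
    (hx : |x| < L.δ) (hh : |h - hc| < L.δ) (hη : 0 < η)
    (hneg : ∀ y ∈ Set.Ioo (x - η) x, L.g y h ≤ 0)
    (hpos : ∀ y ∈ Set.Ioo x (x + η), 0 ≤ L.g y h) : IsStable f h (L.u x h) := by
  have hip := H.ip_coker_pos
  have hx' := abs_lt.1 hx
  have hM := L.M_pos
  refine isStable_of_barriers (H.contDiff.of_le (by norm_num)) (fun ε hε => ?_) (fun ε hε => ?_)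
  · obtain ⟨κ, hκ0, hκ⟩ := exists_between
      (lt_min (lt_min hη (by linarith : 0 < x + L.δ)) (by positivity : 0 < ε / L.M))
    have hκ1 := hκ.trans_le ((min_le_left _ _).trans (min_le_left _ _))
    have hκ2 := hκ.trans_le ((min_le_left _ _).trans (min_le_right _ _))
    have hκ3 : L.M * κ < ε := by
      have := hκ.trans_le (min_le_right _ _)
      rwa [lt_div_iff₀ hM, mul_comm] at this
    have hy : |x - κ| < L.δ := abs_lt.2 ⟨by linarith, by linarith⟩
    refine ⟨L.u (x - κ) h, _, fun t => L.hasDerivAt_u hy hh t, fun t => ?_, ?_, fun t => ?_⟩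
    · have h1 := hneg (x - κ) ⟨by linarith, by linarith⟩
      have h2 : L.g (x - κ) h / ip (cokerFun f x₀) (cokerFun f x₀) * cokerFun f x₀ t ≤ 0 :=
        mul_nonpos_of_nonpos_of_nonneg (div_nonpos_of_nonpos_of_nonneg h1 hip.le)
          (cokerFun_pos f x₀ t).le
      linarith
    · have h1 := L.lower hy hx hh (by linarith) 0
      have h2 : 0 < L.m * (x - (x - κ)) := mul_pos L.m_pos (by linarith)
      linarith
    · have h1 := L.upper hy hx hh (by linarith) t
      rw [sub_sub_cancel] at h1
      linarith
  · obtain ⟨κ, hκ0, hκ⟩ := exists_between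
      (lt_min (lt_min hη (by linarith : 0 < L.δ - x)) (by positivity : 0 < ε / L.M))
    have hκ1 := hκ.trans_le ((min_le_left _ _).trans (min_le_left _ _))
    have hκ2 := hκ.trans_le ((min_le_left _ _).trans (min_le_right _ _))
    have hκ3 : L.M * κ < ε := by
      have := hκ.trans_le (min_le_right _ _)
      rwa [lt_div_iff₀ hM, mul_comm] at this
    have hy : |x + κ| < L.δ := abs_lt.2 ⟨by linarith, by linarith⟩
    refine ⟨L.u (x + κ) h, _, fun t => L.hasDerivAt_u hy hh t, fun t => ?_, ?_, fun t => ?_⟩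
    · have h1 := hpos (x + κ) ⟨by linarith, by linarith⟩
      have h2 : 0 ≤ L.g (x + κ) h / ip (cokerFun f x₀) (cokerFun f x₀) * cokerFun f x₀ t :=
        mul_nonneg (div_nonneg h1 hip.le) (cokerFun_pos f x₀ t).le
      linarith
    · have h1 := L.lower hx hy hh (by linarith) 0
      have h2 : 0 < L.m * (x + κ - x) := mul_pos L.m_pos (by linarith)
      linarith
    · have h1 := L.upper hx hy hh (by linarith) t
      rw [add_sub_cancel_left] at h1
      linarith

/-- If `g(·, h) < 0` just above `x`, then sliding slowly up the family produces subsolutions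
`t ↦ u (a + κ t) h t` that carry nearby solutions away from `u x h`. -/
theorem not_isStable (L : ReducedFamily f hc x₀) (H : IsCritical f hc x₀) {x h η : ℝ}
    (hx : |x| < L.δ) (hh : |h - hc| < L.δ) (hη : 0 < η)
    (hneg : ∀ y ∈ Set.Ioo x (x + η), L.g y h < 0) : ¬ IsStable f h (L.u x h) := by
  have hip := H.ip_coker_pos
  have hx' := abs_lt.1 hx
  have hM := L.M_pos
  obtain ⟨η', hη'0, hη'⟩ := exists_between (lt_min hη (by linarith : 0 < L.δ - x))
  have hη1 := hη'.trans_le (min_le_left _ _)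
  have hη2 := hη'.trans_le (min_le_right _ _)
  refine not_isStable_of_subsolutions (H.contDiff.of_le (by norm_num))
    (L.isC1Periodic hx hh).1.continuous (mul_pos L.m_pos hη'0) fun δ hδ => ?_
  obtain ⟨a, ha0, ha⟩ := exists_between (lt_min hη'0 (by positivity : 0 < δ / L.M))
  have ha1 := ha.trans_le (min_le_left _ _)
  have ha2 : L.M * a < δ := by
    have := ha.trans_le (min_le_right _ _)
    rwa [lt_div_iff₀ hM, mul_comm] at this
  have hbox : ∀ y ∈ Set.Icc (x + a) (x + η'), |y| < L.δ := fun y hy =>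
    abs_lt.2 ⟨by linarith [hy.1], by linarith [hy.2]⟩
  have hcont : ContinuousOn (fun y => L.g y h) (Set.Icc (x + a) (x + η')) := fun y hy => by
    have h1 : ContinuousAt (fun p : ℝ × ℝ => L.g p.1 p.2) (y, h) :=
      (L.contDiffAt (hbox y hy) hh).continuousAt
    exact (ContinuousAt.comp (f := fun y : ℝ => (y, h)) h1 (by fun_prop)).continuousWithinAt
  obtain ⟨y₀, hy₀, hmax⟩ := isCompact_Icc.exists_isMaxOn
    (Set.nonempty_Icc.2 (by linarith : x + a ≤ x + η')) hcont
  have hμ : L.g y₀ h < 0 := hneg y₀ ⟨by linarith [hy₀.1], by linarith [hy₀.2]⟩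
  have hkpos : 0 < ‖H.circleKer‖ := (kerFun_pos f x₀ 0).trans_le (H.kerFun_le 0)
  -- The sliding rate is small enough for the family to remain a subsolution.
  set κ := -L.g y₀ h / ip (cokerFun f x₀) (cokerFun f x₀) * ‖H.circleKer‖⁻¹ / L.M with hκdef
  have hκ : 0 < κ := by
    have : 0 < -L.g y₀ h := by linarith
    positivity
  have hT : 0 ≤ (η' - a) / κ := div_nonneg (by linarith) hκ.le
  have hrange : ∀ t ∈ Set.Icc 0 ((η' - a) / κ), x + a + κ * t ∈ Set.Icc (x + a) (x + η') := by
    intro t ht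
    have h1 : 0 ≤ κ * t := mul_nonneg hκ.le ht.1
    have h2 : κ * t ≤ η' - a := by
      have := ht.2
      rwa [le_div_iff₀ hκ, mul_comm] at this
    exact ⟨by linarith, by linarith⟩
  have hslide : ∀ t, ∃ d, t ∈ Set.Icc 0 ((η' - a) / κ) → d ≤ L.M ∧
      HasDerivAt (fun τ => L.u (x + a + κ * τ) h τ)
        (deriv (L.u (x + a + κ * t) h) t + κ * d) t := by
    intro t
    by_cases ht : t ∈ Set.Icc 0 ((η' - a) / κ)
    · obtain ⟨d, hd1, hd2⟩ := L.slide (hbox _ (hrange t ht)) hh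
      exact ⟨d, fun _ => ⟨hd1, hd2⟩⟩
    · exact ⟨0, fun h => absurd h ht⟩
  choose d hd using hslide
  refine ⟨(η' - a) / κ, hT, fun τ => L.u (x + a + κ * τ) h τ, _, fun t ht => (hd t ht).2,
    fun t ht => ?_, ?_, ?_⟩
  · have hy := hrange t ht
    rw [(L.hasDerivAt_u (hbox _ hy) hh t).deriv]
    have h1 : L.g (x + a + κ * t) h ≤ L.g y₀ h := hmax hy
    have h2 : κ * d t ≤ κ * L.M := mul_le_mul_of_nonneg_left (hd t ht).1 hκ.le
    have h3 : κ * L.M = -L.g y₀ h / ip (cokerFun f x₀) (cokerFun f x₀) * ‖H.circleKer‖⁻¹ := by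
      rw [hκdef]
      field_simp
    have h4 : -L.g y₀ h / ip (cokerFun f x₀) (cokerFun f x₀) * ‖H.circleKer‖⁻¹ ≤
        -L.g (x + a + κ * t) h / ip (cokerFun f x₀) (cokerFun f x₀) * cokerFun f x₀ t := by
      have h5 : 0 ≤ -L.g y₀ h := by linarith
      have h6 := H.le_cokerFun t
      have h7 : 0 ≤ -L.g (x + a + κ * t) h := by linarith
      gcongr
    have h5 : -L.g (x + a + κ * t) h / ip (cokerFun f x₀) (cokerFun f x₀) * cokerFun f x₀ t =
        -(L.g (x + a + κ * t) h / ip (cokerFun f x₀) (cokerFun f x₀) * cokerFun f x₀ t) := by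
      ring
    simp only
    linarith
  · have hy := hbox (x + a) ⟨le_rfl, by linarith⟩
    have h1 := L.upper hx hy hh (by linarith) 0
    have h2 := L.lower hx hy hh (by linarith) 0
    have h3 : 0 ≤ L.m * (x + a - x) := mul_nonneg L.m_pos.le (by linarith)
    rw [add_sub_cancel_left] at h1
    simp only [mul_zero, add_zero]
    rw [abs_of_nonneg (by linarith)]
    linarith
  · have hy := hbox (x + η') ⟨by linarith, le_rfl⟩
    have h1 := L.lower hx hy hh (by linarith) ((η' - a) / κ)
    have h2 : x + a + κ * ((η' - a) / κ) = x + η' := by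
      field_simp
      ring
    simp only [h2]
    rw [add_sub_cancel_left] at h1
    linarith

end ReducedFamily

/-! ### Zeros of a family of strictly convex functions -/

/-- The partial derivative in the first variable of a `C^(n+1)` function is `C^n`. -/
theorem exists_partialDeriv {F : ℝ × ℝ → ℝ} {p : ℝ × ℝ} {n : ℕ} (hF : ContDiffAt ℝ (n + 1) F p) :
    ∃ F' : ℝ × ℝ → ℝ, ContDiffAt ℝ n F' p ∧
      ∀ᶠ q : ℝ × ℝ in 𝓝 p, HasDerivAt (fun x => F (x, q.2)) (F' q) q.1 := by
  refine ⟨fun q => fderiv ℝ F q (1, 0), (hF.fderiv_right le_rfl).clm_apply contDiffAt_const, ?_⟩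
  filter_upwards [hF.eventually (by exact_mod_cast WithTop.coe_ne_top)] with q hq
  have h1 := (hq.differentiableAt (by simp)).hasFDerivAt
  have h2 : HasDerivAt (fun x : ℝ => (x, q.2)) ((1 : ℝ), (0 : ℝ)) q.1 :=
    (hasDerivAt_id q.1).prodMk (hasDerivAt_const q.1 q.2)
  exact HasFDerivAt.comp_hasDerivAt (f := fun x : ℝ => (x, q.2)) q.1 h1 h2

/-- A family of odd `C³` functions with positive third derivative at `0` is strictly convex on a
common interval `[0, η]`: the second derivative vanishes at `0` and increases. -/
theorem exists_strictConvexOn_of_odd {G : ℝ → ℝ → ℝ} {hc : ℝ}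
    (hG : ContDiffAt ℝ 3 (fun p : ℝ × ℝ => G p.1 p.2) (0, hc))
    (hodd : ∀ᶠ p : ℝ × ℝ in 𝓝 (0, hc), G (-p.1) p.2 = -G p.1 p.2)
    (hpos : 0 < iteratedDeriv 3 (fun x => G x hc) 0) :
    ∃ η > 0, ∀ᶠ h in 𝓝 hc, StrictConvexOn ℝ (Set.Icc 0 η) (fun x => G x h) := by
  obtain ⟨F1, hF1, hd1⟩ := exists_partialDeriv (n := 2) (by exact_mod_cast hG)
  obtain ⟨F2, hF2, hd2⟩ := exists_partialDeriv (n := 1) (by exact_mod_cast hF1)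
  obtain ⟨F3, hF3, hd3⟩ := exists_partialDeriv (n := 0) (by exact_mod_cast hF2)
  have hslice : ∀ {P : ℝ × ℝ → Prop} {q : ℝ × ℝ}, (∀ᶠ p in 𝓝 q, P p) →
      ∀ᶠ x in 𝓝 q.1, P (x, q.2) := fun {P q} h =>
    (Continuous.tendsto (by fun_prop : Continuous fun x : ℝ => (x, q.2)) q.1).eventually h
  have hderiv1 : ∀ᶠ q : ℝ × ℝ in 𝓝 (0, hc), deriv (fun x => G x q.2) q.1 = F1 q :=
    hd1.mono fun q hq => hq.deriv
  have hderiv2 : ∀ᶠ q : ℝ × ℝ in 𝓝 (0, hc), deriv (deriv (fun x => G x q.2)) q.1 = F2 q := by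
    filter_upwards [hderiv1.eventually_nhds, hd2] with q hq1 hq2
    have h1 : deriv (fun x => G x q.2) =ᶠ[𝓝 q.1] fun x => F1 (x, q.2) := hslice hq1
    rw [h1.deriv_eq, hq2.deriv]
  have hderiv3 : deriv (deriv (deriv (fun x => G x hc))) 0 = F3 (0, hc) := by
    have h1 : deriv (deriv (fun x => G x hc)) =ᶠ[𝓝 0] fun x => F2 (x, hc) := hslice hderiv2
    rw [h1.deriv_eq]
    exact hd3.self_of_nhds.deriv
  have hF3pos : 0 < F3 (0, hc) := by
    rw [← hderiv3]
    simpa [iteratedDeriv_succ] using hpos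
  have hev := ((hodd.and hd1).and (hderiv2.and hd3)).and
    (hF3.continuousAt.tendsto.eventually_const_lt hF3pos)
  obtain ⟨ε, hε, hball⟩ := Metric.eventually_nhds_iff_ball.1 hev
  have hbox : ∀ {x h : ℝ}, |x| < ε → |h - hc| < ε → (x, h) ∈ Metric.ball ((0 : ℝ), hc) ε := by
    intro x h hx hh
    rw [Metric.mem_ball, Prod.dist_eq, Real.dist_eq, Real.dist_eq, sub_zero]
    exact max_lt hx hh
  refine ⟨ε / 2, half_pos hε, ?_⟩
  filter_upwards [Metric.ball_mem_nhds hc hε] with h hh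
  rw [Metric.mem_ball, Real.dist_eq] at hh
  have hx : ∀ x ∈ Set.Icc 0 (ε / 2), |x| < ε := fun x hx => by
    rw [abs_of_nonneg hx.1]
    linarith [hx.2]
  have hzero : F2 (0, h) = 0 := by
    have h1 : (fun x => G (-x) h) =ᶠ[𝓝 0] fun x => -G x h := by
      filter_upwards [Metric.ball_mem_nhds (0 : ℝ) hε] with x hx
      rw [Metric.mem_ball, Real.dist_eq, sub_zero] at hx
      exact (hball _ (hbox hx hh)).1.1.1
    have h2 := h1.iteratedDeriv_eq 2
    have h3 : iteratedDeriv 2 (fun x => G x h) 0 = F2 (0, h) := by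
      simpa [iteratedDeriv_succ] using (hball _ (hbox (x := 0) (by simpa using hε) hh)).1.2.1
    rw [iteratedDeriv_comp_neg 2 (fun x => G x h), iteratedDeriv_fun_neg, neg_zero, h3] at h2
    norm_num at h2
    linarith
  have hmono : StrictMonoOn (fun x => F2 (x, h)) (Set.Icc 0 (ε / 2)) := by
    have hd := fun x (hx' : x ∈ Set.Icc 0 (ε / 2)) => (hball _ (hbox (hx x hx') hh)).1.2.2
    refine strictMonoOn_of_deriv_pos (convex_Icc _ _)
      (fun x hx => (hd x hx).continuousAt.continuousWithinAt) fun x hx' => ?_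
    have hx' := interior_subset hx'
    rw [(hd x hx').deriv]
    exact (hball _ (hbox (hx x hx') hh)).2
  refine strictConvexOn_of_deriv2_pos (convex_Icc _ _) (fun x hx' =>
    (hball _ (hbox (hx x hx') hh)).1.1.2.continuousAt.continuousWithinAt) fun x hx' => ?_
  rw [interior_Icc] at hx'
  have hxI : x ∈ Set.Icc 0 (ε / 2) := Set.Ioo_subset_Icc_self hx'
  have h1 := hmono (Set.left_mem_Icc.2 (by linarith)) hxI hx'.1
  simp only [hzero] at h1
  have h2 := (hball _ (hbox (hx x hxI) hh)).1.2.1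
  simpa [← h2] using h1

theorem neg_of_strictConvexOn {φ : ℝ → ℝ} {η x w : ℝ} (hφ : StrictConvexOn ℝ (Set.Icc 0 η) φ)
    (h0 : φ 0 = 0) (hx : x ≤ η) (hφx : φ x ≤ 0) (hw : w ∈ Set.Ioo 0 x) : φ w < 0 := by
  have hx0 : 0 < x := hw.1.trans hw.2
  have hw0 := hw.1
  have h := hφ.2 (Set.left_mem_Icc.2 (hx0.le.trans hx)) (⟨hx0.le, hx⟩ : x ∈ Set.Icc 0 η) hx0.ne
    (sub_pos.2 ((div_lt_one hx0).2 hw.2)) (div_pos hw0 hx0) (sub_add_cancel 1 (w / x))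
  simp only [smul_eq_mul, mul_zero, zero_add, h0] at h
  rw [div_mul_cancel₀ _ hx0.ne'] at h
  exact h.trans_le (mul_nonpos_of_nonneg_of_nonpos (by positivity) hφx)

theorem pos_of_strictConvexOn {φ : ℝ → ℝ} {η y x : ℝ} (hφ : StrictConvexOn ℝ (Set.Icc 0 η) φ)
    (h0 : φ 0 = 0) (hy : 0 < y) (hφy : φ y = 0) (hx : x ∈ Set.Ioc y η) : 0 < φ x := by
  by_contra hcon
  exact (neg_of_strictConvexOn hφ h0 hx.2 (not_lt.1 hcon) ⟨hy, hx.1⟩).ne hφy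

theorem eq_of_strictConvexOn {φ : ℝ → ℝ} {η y x : ℝ} (hφ : StrictConvexOn ℝ (Set.Icc 0 η) φ)
    (h0 : φ 0 = 0) (hy : y ∈ Set.Ioo 0 η) (hφy : φ y = 0) (hx : x ∈ Set.Ioo 0 η) (hφx : φ x = 0) :
    x = y := by
  rcases lt_trichotomy x y with h | h | h
  · exact absurd hφy (pos_of_strictConvexOn hφ h0 hx.1 hφx ⟨h, hy.2.le⟩).ne'
  · exact h
  · exact absurd hφx (pos_of_strictConvexOn hφ h0 hy.1 hφy ⟨h, hx.2.le⟩).ne'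

/-- A continuous family of strictly convex functions on `[0, η]` vanishing at `0`, positive on
`(0, η)` at `hc` but not for `h ∈ side`, has for these `h` a unique positive zero, which is
continuous and tends to `0`. -/
theorem exists_zero_branch {G : ℝ → ℝ → ℝ} {hc η : ℝ} (hη : 0 < η) {side : Set ℝ}
    (hconv : ∀ᶠ h in 𝓝 hc, StrictConvexOn ℝ (Set.Icc 0 η) (fun x => G x h))
    (hzero : ∀ᶠ h in 𝓝 hc, G 0 h = 0)
    (hcont : ∀ᶠ h in 𝓝 hc, ∀ x ∈ Set.Icc 0 η, ContinuousAt (fun p : ℝ × ℝ => G p.1 p.2) (x, h))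
    (hpos : ∀ x ∈ Set.Ioo 0 η, 0 < G x hc)
    (hneg : ∀ᶠ h in 𝓝[side] hc, ∃ x ∈ Set.Ioo 0 η, G x h ≤ 0) :
    ∃ y : ℝ → ℝ, (∀ᶠ h in 𝓝[side] hc, y h ∈ Set.Ioo 0 η ∧ G (y h) h = 0 ∧ ContinuousAt y h) ∧
      Tendsto y (𝓝[side] hc) (𝓝 0) := by
  classical
  let y : ℝ → ℝ := fun h => if hex : ∃ x ∈ Set.Ioo 0 η, G x h = 0 then hex.choose else 0
  have hslice : ∀ {x h : ℝ}, ContinuousAt (fun p : ℝ × ℝ => G p.1 p.2) (x, h) →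
      ContinuousAt (fun k => G x k) h := fun {x h} hx =>
    ContinuousAt.comp (f := fun k : ℝ => (x, k)) hx (by fun_prop)
  -- A nonpositive value below a positive value forces a zero in between.
  have hexists : ∀ {h a b : ℝ},
      (∀ x ∈ Set.Icc 0 η, ContinuousAt (fun p : ℝ × ℝ => G p.1 p.2) (x, h)) →
      0 ≤ a → a ≤ b → b ≤ η → G a h ≤ 0 → 0 < G b h → ∃ x ∈ Set.Ico a b, G x h = 0 := by
    intro h a b hch ha hab hb hGa hGb
    have hc' : ContinuousOn (fun x => G x h) (Set.Icc a b) := fun x hx =>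
      (ContinuousAt.comp (f := fun x : ℝ => (x, h)) (hch x ⟨ha.trans hx.1, hx.2.trans hb⟩)
        (by fun_prop)).continuousWithinAt
    obtain ⟨x, hx, hGx⟩ := intermediate_value_Icc hab hc' ⟨hGa, hGb.le⟩
    refine ⟨x, ⟨hx.1, hx.2.lt_of_ne ?_⟩, hGx⟩
    rintro rfl
    exact hGb.ne' hGx
  have hy : ∀ {h x : ℝ}, StrictConvexOn ℝ (Set.Icc 0 η) (fun x => G x h) → G 0 h = 0 →
      x ∈ Set.Ioo 0 η → G x h = 0 → y h = x := by
    intro h x hch h0 hx hGx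
    have hex : ∃ x ∈ Set.Ioo 0 η, G x h = 0 := ⟨x, hx, hGx⟩
    have hyh : y h = hex.choose := dif_pos hex
    rw [hyh]
    exact eq_of_strictConvexOn hch h0 hx hGx hex.choose_spec.1 hex.choose_spec.2
  have hsmall : ∀ η' ∈ Set.Ioo 0 η, ∀ᶠ h in 𝓝[side] hc,
      y h ∈ Set.Ioo 0 η' ∧ G (y h) h = 0 := by
    intro η' hη'
    have h1 : ∀ᶠ h in 𝓝 hc, 0 < G η' h :=
      (hslice (hcont.self_of_nhds η' ⟨hη'.1.le, hη'.2.le⟩)).tendsto.eventually_const_lt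
        (hpos η' hη')
    filter_upwards [hneg, nhdsWithin_le_nhds h1, nhdsWithin_le_nhds hconv,
      nhdsWithin_le_nhds hzero, nhdsWithin_le_nhds hcont] with h hnegh hposh hch h0 hcth
    obtain ⟨x, hx, hGx⟩ := hnegh
    have hlt : x < η' := by
      rcases lt_trichotomy x η' with h | h | h
      · exact h
      · rw [h] at hGx
        exact absurd hposh (not_lt.2 hGx)
      · exact absurd hposh (not_lt.2 (neg_of_strictConvexOn hch h0 hx.2.le hGx ⟨hη'.1, h⟩).le)
    obtain ⟨z, hz, hGz⟩ := hexists hcth hx.1.le hlt.le hη'.2.le hGx hposh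
    have hz' : z ∈ Set.Ioo 0 η := ⟨hx.1.trans_le hz.1, hz.2.trans hη'.2⟩
    rw [hy hch h0 hz' hGz]
    exact ⟨⟨hz'.1, hz.2⟩, hGz⟩
  refine ⟨y, ?_, ?_⟩
  · have h1 := hsmall (η / 2) ⟨half_pos hη, half_lt_self hη⟩
    filter_upwards [h1, nhdsWithin_le_nhds hconv.eventually_nhds,
      nhdsWithin_le_nhds hzero.eventually_nhds,
      nhdsWithin_le_nhds hcont.eventually_nhds] with h hyh hch h0 hcth
    have hyI : y h ∈ Set.Ioo 0 η := ⟨hyh.1.1, hyh.1.2.trans (half_lt_self hη)⟩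
    refine ⟨hyI, hyh.2, ?_⟩
    -- The sign change at `y h` persists for nearby parameters.
    refine Metric.continuousAt_iff'.2 fun ε hε => ?_
    obtain ⟨κ, hκ0, hκ⟩ := exists_between (lt_min (lt_min hε hyI.1) (sub_pos.2 hyI.2))
    have hκ1 := hκ.trans_le ((min_le_left _ _).trans (min_le_left _ _))
    have hκ2 := hκ.trans_le ((min_le_left _ _).trans (min_le_right _ _))
    have hκ3 := hκ.trans_le (min_le_right _ _)
    have hl : G (y h - κ) h < 0 :=
      neg_of_strictConvexOn (φ := fun x => G x h) hch.self_of_nhds h0.self_of_nhds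
      hyI.2.le hyh.2.le ⟨by linarith, by linarith⟩
    have hr : 0 < G (y h + κ) h :=
      pos_of_strictConvexOn (φ := fun x => G x h) hch.self_of_nhds h0.self_of_nhds
      hyI.1 hyh.2 ⟨by linarith, by linarith⟩
    have hlk := (hslice (hcth.self_of_nhds (y h - κ)
      ⟨by linarith, by linarith⟩)).tendsto.eventually_lt_const hl
    have hrk := (hslice (hcth.self_of_nhds (y h + κ)
      ⟨by linarith, by linarith⟩)).tendsto.eventually_const_lt hr
    filter_upwards [hch, h0, hcth, hlk, hrk] with k hchk h0k hcthk hlk hrk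
    obtain ⟨x, hx, hGx⟩ :=
      hexists hcthk (by linarith) (by linarith) (by linarith) hlk.le hrk
    rw [hy hchk h0k ⟨by linarith [hx.1], by linarith [hx.2]⟩ hGx, Real.dist_eq, abs_lt]
    exact ⟨by linarith [hx.1], by linarith [hx.2]⟩
  · refine Metric.tendsto_nhds.2 fun ε hε => ?_
    have hη' : min (ε / 2) (η / 2) ∈ Set.Ioo 0 η :=
      ⟨by positivity, (min_le_right _ _).trans_lt (half_lt_self hη)⟩
    filter_upwards [hsmall _ hη'] with h hh
    rw [Real.dist_eq, sub_zero, abs_of_pos hh.1.1]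
    have := hh.1.2.trans_le (min_le_left _ _)
    linarith

/-! ### The pitchfork -/

namespace IsCritical

theorem abs_ip_ker_le (H : IsCritical f hc x₀) {w : ℝ → ℝ} {r : ℝ} (hnear : Near r w x₀) :
    |ip (kerFun f x₀) (fun t => w t - x₀ t)| ≤ ‖H.circleKer‖ * r := by
  have h := intervalIntegral.norm_integral_le_of_norm_le_const (a := (0 : ℝ)) (b := 1)
    (f := fun t => kerFun f x₀ t * (w t - x₀ t)) (C := ‖H.circleKer‖ * r) fun t _ => by
      rw [norm_mul, Real.norm_of_nonneg (kerFun_pos f x₀ t).le]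
      exact mul_le_mul (H.kerFun_le t) (hnear t).le (norm_nonneg _) (norm_nonneg _)
  simpa [ip] using h

end IsCritical

namespace ReducedFamily

/-- In a small uniform neighbourhood of `x₀`, the periodic solutions are the members of the family
at the small zeros of `g`. -/
theorem exists_coord (L : ReducedFamily f hc x₀) (H : IsCritical f hc x₀) {η : ℝ} (hη : 0 < η) :
    ∃ r > 0, r ≤ L.r ∧ ∀ {h : ℝ}, |h - hc| < L.δ → ∀ {w : ℝ → ℝ}, IsPeriodicSolution f h w →
      Near r w x₀ → ∃ x, |x| < η ∧ w = L.u x h ∧ L.g x h = 0 := by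
  have hip := H.ip_ker_pos
  have hk : 0 < ‖H.circleKer‖ := (kerFun_pos f x₀ 0).trans_le (H.kerFun_le 0)
  obtain ⟨e, he0, he⟩ := exists_between (lt_min hη L.δ_pos)
  refine ⟨min L.r (e * ip (kerFun f x₀) (kerFun f x₀) / ‖H.circleKer‖),
    lt_min L.r_pos (by positivity), min_le_left _ _, fun {h} hh {w} hw hnear => ?_⟩
  have h1 := H.abs_ip_ker_le hnear
  have h2 : ‖H.circleKer‖ * min L.r (e * ip (kerFun f x₀) (kerFun f x₀) / ‖H.circleKer‖) ≤
      e * ip (kerFun f x₀) (kerFun f x₀) := by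
    calc _ ≤ ‖H.circleKer‖ * (e * ip (kerFun f x₀) (kerFun f x₀) / ‖H.circleKer‖) := by
          gcongr; exact min_le_right _ _
      _ = _ := by field_simp
  set x := ip (kerFun f x₀) (fun t => w t - x₀ t) / ip (kerFun f x₀) (kerFun f x₀) with hxdef
  have hx : |x| ≤ e := by
    rw [hxdef, abs_div, abs_of_pos hip, div_le_iff₀ hip]
    exact h1.trans h2
  obtain ⟨h3, h4⟩ := L.unique (hx.trans_lt (he.trans_le (min_le_right _ _))) hh hw.1
    (hw.Phi_eq x₀) (by rw [hxdef, div_mul_cancel₀ _ hip.ne'])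
    (fun t => (hnear t).trans_le (min_le_left _ _))
  exact ⟨x, hx.trans_lt (he.trans_le (min_le_left _ _)), h3, by rw [← h4, zero_mul]⟩

/-- The symmetric branch is the part `x = 0` of the family. -/
theorem eventually_branch {X : ℝ → ℝ → ℝ} (L : ReducedFamily f hc (X hc))
    (H : IsCritical f hc (X hc)) (hodd : ∀ x, f (-x) = -f x) (hX : IsSymmetricBranch f hc X) :
    ∀ᶠ h in 𝓝 hc, X h = L.u 0 h ∧ L.g 0 h = 0 := by
  filter_upwards [hX.1, hX.2 _ L.r_pos, L.eventually_box_snd] with h h1 h2 h3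
  exact L.eq_of_symmetric H hodd hX.1.self_of_nhds.2 h3 h1.1 h1.2 h2

theorem exists_odd_box {X : ℝ → ℝ → ℝ} (L : ReducedFamily f hc (X hc))
    (H : IsCritical f hc (X hc)) (hodd : ∀ x, f (-x) = -f x) (hX : IsSymmetricBranch f hc X) :
    ∃ η > 0, η < L.δ ∧ ∀ᶠ h in 𝓝 hc, |h - hc| < L.δ ∧ ∀ x, |x| ≤ η →
      L.u (-x) h = reflect (L.u x h) ∧ L.g (-x) h = -L.g x h := by
  obtain ⟨ε, hε, hball⟩ := Metric.eventually_nhds_iff_ball.1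
    (L.eventually_odd H hodd hX.1.self_of_nhds.2)
  obtain ⟨η, hη0, hη⟩ := exists_between (lt_min hε L.δ_pos)
  refine ⟨η, hη0, hη.trans_le (min_le_right _ _), ?_⟩
  filter_upwards [L.eventually_box_snd, Metric.ball_mem_nhds hc hε] with h hh hh'
  refine ⟨hh, fun x hx => hball (x, h) ?_⟩
  rw [Metric.mem_ball, Prod.dist_eq, Real.dist_eq, sub_zero]
  exact max_lt (hx.trans_lt (hη.trans_le (min_le_left _ _))) hh'

/-- Near `hc`, the symmetric solution is stable if `g(·, h)` is positive just above `0`, and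
unstable if it is negative there. -/
theorem eventually_stability {X : ℝ → ℝ → ℝ} (L : ReducedFamily f hc (X hc))
    (H : IsCritical f hc (X hc)) (hodd : ∀ x, f (-x) = -f x) (hX : IsSymmetricBranch f hc X) :
    ∀ᶠ h in 𝓝 hc,
      ((∃ ρ > 0, ∀ x ∈ Set.Ioo 0 ρ, 0 < L.g x h) → IsStable f h (X h)) ∧
      ((∃ ρ > 0, ∀ x ∈ Set.Ioo 0 ρ, L.g x h < 0) → ¬ IsStable f h (X h)) := by
  obtain ⟨η, hη0, -, hbox⟩ := L.exists_odd_box H hodd hX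
  have hz : |(0 : ℝ)| < L.δ := by simpa using L.δ_pos
  filter_upwards [hbox, L.eventually_branch H hodd hX] with h hh hX0
  rw [hX0.1]
  refine ⟨?_, ?_⟩
  · rintro ⟨ρ, hρ, hpos⟩
    refine L.isStable H hz hh.1 (lt_min hρ hη0) (fun y hy => ?_) fun y hy => ?_
    · have hy1 : -y < min ρ η := by linarith [hy.1]
      have h1 := (hh.2 (-y) (by
        rw [abs_of_pos (by linarith [hy.2])]
        exact (hy1.trans_le (min_le_right _ _)).le)).2
      rw [neg_neg] at h1
      have h2 := hpos (-y) ⟨by linarith [hy.2], hy1.trans_le (min_le_left _ _)⟩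
      linarith
    · rw [zero_add] at hy
      exact (hpos y ⟨hy.1, hy.2.trans_le (min_le_left _ _)⟩).le
  · rintro ⟨ρ, hρ, hneg⟩
    exact L.not_isStable H hz hh.1 hρ fun y hy => hneg y (by rwa [zero_add] at hy)

/-- The pitchfork, for both signs `σ` of `g_xxx` at once: `σ g(·, h)` is strictly convex on an
interval `[0, η]`; its sign just above `0`, known from the stability of the symmetric branch,
decides whether it has a positive zero. -/
theorem isPitchfork {X : ℝ → ℝ → ℝ} (L : ReducedFamily f hc (X hc))
    (H : IsCritical f hc (X hc)) (hodd : ∀ x, f (-x) = -f x) (hX : IsSymmetricBranch f hc X)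
    {σ : ℝ} (hσ : σ ≠ 0) (hthird : 0 < iteratedDeriv 3 (fun x => σ * L.g x hc) 0)
    {side other : Set ℝ} (hcompl : sideᶜ ⊆ insert hc other) [(𝓝[other] hc).NeBot]
    {S : ℝ → (ℝ → ℝ) → Prop}
    (hside : ∀ᶠ h in 𝓝[side] hc, ¬ ∃ ρ > 0, ∀ x ∈ Set.Ioo 0 ρ, 0 < σ * L.g x h)
    (hother : ∀ᶠ h in 𝓝[other] hc, ¬ ∃ ρ > 0, ∀ x ∈ Set.Ioo 0 ρ, σ * L.g x h < 0)
    (hS : ∀ {x h ρ : ℝ}, |x| < L.δ → |h - hc| < L.δ → 0 < ρ →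
      (∀ y ∈ Set.Ioo (x - ρ) x, σ * L.g y h < 0) → (∀ y ∈ Set.Ioo x (x + ρ), 0 < σ * L.g y h) →
      S h (L.u x h)) :
    IsPitchfork f hc X side S := by
  have hsym : reflect (X hc) = X hc := hX.1.self_of_nhds.2
  have hz : |(0 : ℝ)| < L.δ := by simpa using L.δ_pos
  have hhc : |hc - hc| < L.δ := by simpa using L.δ_pos
  obtain ⟨η₁, hη₁, hη₁δ, hbox⟩ := L.exists_odd_box H hodd hX
  obtain ⟨η₂, hη₂, hconv₂⟩ := exists_strictConvexOn_of_odd (G := fun x h => σ * L.g x h)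
    (contDiffAt_const.mul (L.contDiffAt hz hhc))
    ((L.eventually_odd H hodd hsym).mono fun p hp => by rw [hp.2, mul_neg]) hthird
  obtain ⟨η, hη, hη12⟩ := exists_between (lt_min hη₁ hη₂)
  have hη1 : η ≤ η₁ := (hη12.trans_le (min_le_left _ _)).le
  have hη2 : η ≤ η₂ := (hη12.trans_le (min_le_right _ _)).le
  have hδ : ∀ {x : ℝ}, |x| ≤ η → |x| < L.δ := fun hx => hx.trans_lt (hη1.trans_lt hη₁δ)
  have hconv : ∀ᶠ h in 𝓝 hc, StrictConvexOn ℝ (Set.Icc 0 η) (fun x => σ * L.g x h) :=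
    hconv₂.mono fun h hh => hh.subset (Set.Icc_subset_Icc_right hη2) (convex_Icc _ _)
  have hbranch := L.eventually_branch H hodd hX
  have hzero : ∀ᶠ h in 𝓝 hc, σ * L.g 0 h = 0 := hbranch.mono fun h hh => by rw [hh.2, mul_zero]
  have hcont : ∀ᶠ h in 𝓝 hc, ∀ x ∈ Set.Icc 0 η,
      ContinuousAt (fun p : ℝ × ℝ => σ * L.g p.1 p.2) (x, h) := by
    filter_upwards [L.eventually_box_snd] with h hh x hx
    exact continuousAt_const.mul
      (L.contDiffAt (hδ (by rw [abs_of_nonneg hx.1]; exact hx.2)) hh).continuousAt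
  -- On the other side there is no zero; at `hc` itself this follows by passing to the limit.
  have hposother : ∀ᶠ h in 𝓝[other] hc, ∀ x ∈ Set.Ioo 0 η, 0 < σ * L.g x h := by
    filter_upwards [hother, nhdsWithin_le_nhds hconv, nhdsWithin_le_nhds hzero]
      with h hh hch h0 x hx
    by_contra hcon
    exact hh ⟨x, hx.1, fun w hw =>
      neg_of_strictConvexOn (φ := fun x => σ * L.g x h) hch h0 hx.2.le (not_lt.1 hcon) hw⟩
  have hposc : ∀ x ∈ Set.Ioo 0 η, 0 < σ * L.g x hc := by
    have hnonneg : ∀ x ∈ Set.Ioo 0 η, 0 ≤ σ * L.g x hc := by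
      intro x hx
      have h1 : ContinuousAt (fun k => σ * L.g x k) hc :=
        ContinuousAt.comp (f := fun k : ℝ => (x, k))
          (hcont.self_of_nhds x ⟨hx.1.le, hx.2.le⟩) (by fun_prop)
      exact ge_of_tendsto (h1.tendsto.mono_left nhdsWithin_le_nhds)
        (hposother.mono fun h hh => (hh x hx).le)
    intro x hx
    by_contra hcon
    have h1 := neg_of_strictConvexOn hconv.self_of_nhds hzero.self_of_nhds hx.2.le (not_lt.1 hcon)
      (⟨half_pos hx.1, half_lt_self hx.1⟩ : x / 2 ∈ Set.Ioo 0 x)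
    exact absurd (hnonneg (x / 2) ⟨half_pos hx.1, (half_lt_self hx.1).trans hx.2⟩) (not_le.2 h1)
  have hneg : ∀ᶠ h in 𝓝[side] hc, ∃ x ∈ Set.Ioo 0 η, σ * L.g x h ≤ 0 := by
    filter_upwards [hside] with h hh
    by_contra! hcon
    exact hh ⟨η, hη, hcon⟩
  obtain ⟨y, hy, hy0⟩ := exists_zero_branch hη hconv hzero hcont hposc hneg
  obtain ⟨r, hr, hrL, hcoord⟩ := L.exists_coord H hη
  have htend : Tendsto (fun h => (y h, h)) (𝓝[side] hc) (𝓝 ((0 : ℝ), hc)) :=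
    hy0.prodMk_nhds (tendsto_id.mono_left nhdsWithin_le_nhds)
  refine ⟨r, hr, fun h => L.u (y h) h, ?_, ?_, ?_⟩
  · filter_upwards [hy, nhdsWithin_le_nhds hbox, nhdsWithin_le_nhds hconv,
      nhdsWithin_le_nhds hzero, nhdsWithin_le_nhds hbranch, nhdsWithin_le_nhds hX.1,
      nhdsWithin_le_nhds (hX.2 r hr), htend.eventually (L.eventually_near H hr)]
      with h hyh hh hch h0 hXh hXsol hXnear hYnear
    obtain ⟨hyI, hgy, hyc⟩ := hyh
    have hyabs : |y h| ≤ η := by rw [abs_of_pos hyI.1]; exact hyI.2.le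
    have hyδ := hδ hyabs
    have hnyδ : |-y h| < L.δ := by rwa [abs_neg]
    have hg0 : L.g (y h) h = 0 := (mul_eq_zero.1 hgy).resolve_left hσ
    have hrefl := hh.2 (y h) (hyabs.trans hη1)
    have hoddσ : ∀ x, |x| ≤ η → σ * L.g (-x) h = -(σ * L.g x h) := fun x hx => by
      rw [(hh.2 x (hx.trans hη1)).2, mul_neg]
    have hbelow : ∀ x ∈ Set.Ioo 0 (y h), σ * L.g x h < 0 := fun x hx =>
      neg_of_strictConvexOn (φ := fun x => σ * L.g x h) hch h0 hyI.2.le hgy.le hx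
    have habove : ∀ x ∈ Set.Ioc (y h) η, 0 < σ * L.g x h := fun x hx =>
      pos_of_strictConvexOn (φ := fun x => σ * L.g x h) hch h0 hyI.1 hgy hx
    have huniq : ∀ x ∈ Set.Ioo 0 η, L.g x h = 0 → x = y h := fun x hx hgx =>
      eq_of_strictConvexOn hch h0 hyI hgy hx (by rw [hgx, mul_zero])
    have hρ : 0 < min (y h) (η - y h) := lt_min hyI.1 (sub_pos.2 hyI.2)
    have hρ1 := min_le_left (y h) (η - y h)
    have hρ2 := min_le_right (y h) (η - y h)
    refine ⟨?_, ?_, ?_, ?_, ?_⟩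
    · rw [← hrefl.1]
      intro heq
      have h1 := L.lower hnyδ hyδ hh.1 (by linarith [hyI.1]) 0
      rw [heq, sub_self] at h1
      have h2 : 0 < L.m * (y h - -y h) := mul_pos L.m_pos (by linarith [hyI.1])
      linarith
    · ext w
      simp only [Set.mem_ofPred_eq, Set.mem_insert_iff, Set.mem_singleton_iff]
      constructor
      · rintro ⟨hw, hwnear⟩
        obtain ⟨x, hx, hwx, hgx⟩ := hcoord hh.1 hw hwnear
        rcases lt_trichotomy x 0 with hx0 | hx0 | hx0
        · right; right
          have h1 : -x = y h := huniq (-x) ⟨by linarith, by linarith [(abs_lt.1 hx).1]⟩ (by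
            rw [(hh.2 x (hx.le.trans hη1)).2, hgx, neg_zero])
          rw [hwx, ← hrefl.1, ← h1, neg_neg]
        · left
          rw [hwx, hx0, hXh.1]
        · right; left
          rw [hwx, huniq x ⟨hx0, (abs_lt.1 hx).2⟩ hgx]
      · rintro (rfl | rfl | rfl)
        · exact ⟨hXsol.1, hXnear⟩
        · exact ⟨(L.isPeriodicSolution_iff H hyδ hh.1).2 hg0, hYnear⟩
        · refine ⟨?_, hYnear.reflect hsym⟩
          rw [← hrefl.1, L.isPeriodicSolution_iff H hnyδ hh.1, hrefl.2, hg0, neg_zero]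
    · intro ε hε
      have h1 : Tendsto (fun k => (y k, k)) (𝓝 h) (𝓝 (y h, h)) :=
        hyc.tendsto.prodMk_nhds tendsto_id
      exact h1.eventually (L.continuous hyδ hh.1 ε hε)
    · exact hS hyδ hh.1 hρ (fun x hx => hbelow x ⟨by linarith [hx.1], hx.2⟩)
        fun x hx => habove x ⟨hx.1, by linarith [hx.2]⟩
    · rw [← hrefl.1]
      refine hS hnyδ hh.1 hρ (fun x hx => ?_) fun x hx => ?_
      · have h1 := habove (-x) ⟨by linarith [hx.2], by linarith [hx.1]⟩
        rw [hoddσ x (abs_le.2 ⟨by linarith [hx.1], by linarith [hx.2, hyI.1]⟩)] at h1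
        linarith
      · have h1 := hbelow (-x) ⟨by linarith [hx.2], by linarith [hx.1]⟩
        rw [hoddσ x (abs_le.2 ⟨by linarith [hx.1, hyI.2], by linarith [hx.2]⟩)] at h1
        linarith
  · intro ε hε
    exact htend.eventually (L.eventually_near H hε)
  · have hpos : ∀ᶠ h in 𝓝[sideᶜ] hc, ∀ x ∈ Set.Ioo 0 η, 0 < σ * L.g x h := by
      refine Filter.Eventually.filter_mono (nhdsWithin_mono hc hcompl) ?_
      rw [nhdsWithin_insert, eventually_sup]
      exact ⟨eventually_pure.2 hposc, hposother⟩
    filter_upwards [hpos, nhdsWithin_le_nhds hbox, nhdsWithin_le_nhds hbranch,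
      nhdsWithin_le_nhds hX.1, nhdsWithin_le_nhds (hX.2 r hr)] with h hpos hh hXh hXsol hXnear
    ext w
    simp only [Set.mem_ofPred_eq, Set.mem_singleton_iff]
    constructor
    · rintro ⟨hw, hwnear⟩
      obtain ⟨x, hx, hwx, hgx⟩ := hcoord hh.1 hw hwnear
      rcases lt_trichotomy x 0 with hx0 | hx0 | hx0
      · have h1 := hpos (-x) ⟨by linarith, by linarith [(abs_lt.1 hx).1]⟩
        rw [(hh.2 x (hx.le.trans hη1)).2, hgx, neg_zero, mul_zero] at h1
        exact absurd h1 (lt_irrefl 0)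
      · rw [hwx, hx0, hXh.1]
      · have h1 := hpos x ⟨hx0, (abs_lt.1 hx).2⟩
        rw [hgx, mul_zero] at h1
        exact absurd h1 (lt_irrefl 0)
    · rintro rfl
      exact ⟨hXsol.1, hXnear⟩

end ReducedFamily

end PeriodicBistable

theorem mainTheorem4 (f : ℝ → ℝ) (hf : ContDiff ℝ 3 f) (hodd : ∀ x, f (-x) = -f x)
    (hcs : ℝ) (X : ℝ → ℝ → ℝ)
    (hX : PeriodicBistable.IsSymmetricBranch f hcs X)
    (hgain : PeriodicBistable.IsStabilityGaining f hcs X) :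
    (∃ g : ℝ → ℝ → ℝ, PeriodicBistable.IsReducedFunction f hcs (X hcs) g ∧
      ContDiffAt ℝ 3 (fun p : ℝ × ℝ => g p.1 p.2) (0, hcs)) ∧
    ∀ g : ℝ → ℝ → ℝ, PeriodicBistable.IsReducedFunction f hcs (X hcs) g →
      (0 < PeriodicBistable.gxxx g hcs →
        PeriodicBistable.IsSubcriticalPitchfork f hcs X) ∧
      (PeriodicBistable.gxxx g hcs < 0 →
        PeriodicBistable.IsSupercriticalPitchfork f hcs X) := by
  have H : PeriodicBistable.IsCritical f hcs (X hcs) := ⟨hf, hX.1.self_of_nhds.1, hgain.1⟩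
  obtain ⟨L⟩ := H.exists_reducedFamily
  obtain ⟨-, hunst, hst⟩ := hgain
  have hstab := L.eventually_stability H hodd hX
  refine ⟨⟨L.g, L.isReducedFunction H,
    L.contDiffAt (by simpa using L.δ_pos) (by simpa using L.δ_pos)⟩, fun g hg => ?_⟩
  have hgL : PeriodicBistable.gxxx g hcs = iteratedDeriv 3 (fun x => L.g x hcs) 0 := by
    refine Filter.EventuallyEq.iteratedDeriv_eq 3 ?_
    exact (Continuous.tendsto (by fun_prop : Continuous fun x : ℝ => (x, hcs)) 0).eventually
      (L.eventuallyEq_of_isReducedFunction H hg)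
  rw [hgL]
  refine ⟨fun hpos => ?_, fun hneg => ?_⟩
  · refine L.isPitchfork H hodd hX (σ := 1) one_ne_zero (by simpa using hpos)
      (other := Set.Ioi hcs) (by intro h; simp [le_iff_eq_or_lt]) ?_ ?_ ?_
    · filter_upwards [hunst, nhdsWithin_le_nhds hstab] with h h1 h2
      exact fun hcon => h1 (h2.1 (by simpa only [one_mul] using hcon))
    · filter_upwards [hst, nhdsWithin_le_nhds hstab] with h h1 h2
      exact fun hcon => h2.2 (by simpa using hcon) h1
    · intro x h ρ hx hh hρ hl hr
      exact L.isStable H hx hh hρ (fun y hy => by simpa using (hl y hy).le)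
        fun y hy => by simpa using (hr y hy).le
  · refine L.isPitchfork H hodd hX (σ := -1) (by norm_num) (by simpa using hneg)
      (other := Set.Iio hcs) (by intro h; simp [le_iff_eq_or_lt]) ?_ ?_ ?_
    · filter_upwards [hst, nhdsWithin_le_nhds hstab] with h h1 h2
      exact fun hcon => h2.2 (by simpa using hcon) h1
    · filter_upwards [hunst, nhdsWithin_le_nhds hstab] with h h1 h2
      exact fun hcon => h1 (h2.1 (by simpa using hcon))
    · intro x h ρ hx hh hρ hl hr
      exact L.not_isStable H hx hh hρ fun y hy => by simpa using hr y hy
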